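/- Let $I=[0,1]$. Let $\mathrm{Homeo}_+(I)$ be the group of orientation-preserving homeomorphisms of $I$, and let $\mathrm{Diff}^1_+(I)$ be the group of orientation-preserving $C^1$-diffeomorphisms of $I$ (with one-sided derivatives at the endpoints). Let $F\le\mathrm{Homeo}_+(I)$ be Thompson's group, that is, the group of piecewise linear orientation-preserving homeomorphisms of $I$ with finitely many breakpoints, all of them dyadic rational numbers, and with all slopes powers of two; the inclusion $F\hookrightarrow\mathrm{Homeo}_+(I)$ is called the standard piecewise linear action of $F$ on $I$. An action $\phi\colon F\to\mathrm{Homeo}_+(I)$ is said to be semiconjugate to the standard action if there is a monotone (non-decreasing or non-increasing), surjective, continuous map $h\colon I\to I$ such that $h(\phi(f)(x))=f(h(x))$ for all $f\in F$ and $x\in I$. A group is locally indicable if each of its nontrivial finitely generated subgroups admits a surjective homomorphism onto $\mathbb{Z}$. Assume (a result of Brum, Matte Bon, Rivas and Triestino) that every faithful $C^1$ action of $F$ on $I$, i.e. every injective homomorphism $\phi\colon F\to\mathrm{Diff}^1_+(I)$, is semiconjugate to the standard piecewise linear action of $F$. Then the free product $F*\mathbb{Z}$ is locally indicable, but there is no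 injective homomorphism $F*\mathbb{Z}\to\mathrm{Diff}^1_+(I)$. -/

import Mathlib

open Set Function unitInterval

/-- The group `Homeo₊(I)` of orientation-preserving homeomorphisms of `I = [0,1]`, under composition.
An orientation-preserving homeomorphism of `[0,1]` is the same thing as an increasing bijection
(continuity of the map and of its inverse is then automatic). -/
abbrev HomeoPlus : Type := I ≃o I

/-- A self-map of `I = [0,1]` is `C^1`: as a real function on `[0,1]` it is continuously
differentiable, with one-sided derivatives at the endpoints. -/
def IsC1 (f : I → I) : Prop :=
  ContDiffOn ℝ 1 (IccExtend (zero_le_one' ℝ) (fun x => (f x : ℝ))) (Icc 0 1)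

theorem IsC1.id : IsC1 (fun x => x) := by
  refine contDiffOn_id.congr fun x hx => ?_
  simp [IccExtend_of_mem _ _ hx]

theorem IsC1.comp {g f : I → I} (hg : IsC1 g) (hf : IsC1 f) : IsC1 (fun x => g (f x)) := by
  have h := ContDiffOn.comp (s := Icc (0 : ℝ) 1) hg hf (fun x hx => by
    rw [IccExtend_of_mem _ _ hx]; exact (f ⟨x, hx⟩).2)
  refine h.congr fun x hx => ?_
  simp [IccExtend_of_mem _ _ hx]

/-- The group `Diff₊¹(I)` of orientation-preserving `C^1` diffeomorphisms of `I = [0,1]`. -/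
def DiffPlusOne : Subgroup HomeoPlus where
  carrier := {f | IsC1 (fun x => f x) ∧ IsC1 (fun x => f.symm x)}
  one_mem' := ⟨IsC1.id, IsC1.id⟩
  mul_mem' := fun {_ _} hf hg => ⟨hf.1.comp hg.1, hg.2.comp hf.2⟩
  inv_mem' := fun {_} hf => ⟨hf.2, hf.1⟩

/-- Dyadic rational numbers `m / 2 ^ k`, as a condition on real numbers. -/
def IsDyadic (x : ℝ) : Prop := ∃ (m : ℤ) (k : ℕ), x = m / 2 ^ k

theorem IsDyadic.zero : IsDyadic 0 := ⟨0, 0, by simp⟩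

theorem IsDyadic.add {x y : ℝ} (hx : IsDyadic x) (hy : IsDyadic y) : IsDyadic (x + y) := by
  obtain ⟨m, k, rfl⟩ := hx
  obtain ⟨n, l, rfl⟩ := hy
  refine ⟨m * 2 ^ l + n * 2 ^ k, k + l, ?_⟩
  push_cast
  field_simp
  ring

theorem IsDyadic.neg {x : ℝ} (hx : IsDyadic x) : IsDyadic (-x) := by
  obtain ⟨m, k, rfl⟩ := hx
  exact ⟨-m, k, by push_cast; ring⟩

theorem IsDyadic.sub {x y : ℝ} (hx : IsDyadic x) (hy : IsDyadic y) : IsDyadic (x - y) := by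
  rw [sub_eq_add_neg]; exact hx.add hy.neg

theorem IsDyadic.zpow_mul {x : ℝ} (hx : IsDyadic x) (n : ℤ) : IsDyadic ((2 : ℝ) ^ n * x) := by
  obtain ⟨m, k, rfl⟩ := hx
  obtain ⟨j, rfl | rfl⟩ := n.eq_nat_or_neg
  · exact ⟨2 ^ j * m, k, by push_cast; rw [zpow_natCast]; ring⟩
  · refine ⟨m, k + j, ?_⟩
    rw [zpow_neg, zpow_natCast, pow_add]
    field_simp

/-- `f` is affine with slope `2 ^ n`, for some integer `n`, on the interval `[a, b]`. -/
def AffineTwoPow (f : I → I) (a b : I) : Prop :=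
  ∃ n : ℤ, ∀ x ∈ Icc a b, (f x : ℝ) = f a + 2 ^ n * ((x : ℝ) - a)

/-- `f` is piecewise linear with finitely many breakpoints, all of them dyadic rational numbers, and
all its slopes are powers of two: there is a finite set `S` of dyadic points such that `f` is affine
with slope a power of two on every interval without points of `S` in its interior. -/
def IsDyadicPL (f : I → I) : Prop :=
  ∃ S : Finset I, (∀ s ∈ S, IsDyadic s) ∧
    ∀ a b : I, a ≤ b → Disjoint (Ioo a b) (S : Set I) → AffineTwoPow f a b

/-- The last breakpoint (or `0`) before a positive point. -/
theorem exists_previous (S : Finset I) (hS : ∀ s ∈ S, IsDyadic s) (x : I) (hx : 0 < x) :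
    ∃ a : I, a < x ∧ IsDyadic a ∧ Disjoint (Ioo a x) (S : Set I) := by
  classical
  set T := (insert 0 S).filter (· < x) with hT
  have hne : T.Nonempty := ⟨0, by simp [hT, hx]⟩
  have hm := T.max'_mem hne
  have hm' := Finset.mem_filter.1 hm
  refine ⟨T.max' hne, hm'.2, ?_, ?_⟩
  · rcases Finset.mem_insert.1 hm'.1 with h | h
    · rw [h]; exact IsDyadic.zero
    · exact hS _ h
  · rw [Set.disjoint_left]
    intro y hy hyS
    have : y ∈ T := Finset.mem_filter.2 ⟨Finset.mem_insert_of_mem hyS, hy.2⟩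
    exact absurd (T.le_max' y this) (not_le.2 hy.1)

theorem IsDyadicPL.isDyadic_apply {f : HomeoPlus} (hf : IsDyadicPL f) (x : I)
    (hx : IsDyadic x) : IsDyadic (f x) := by
  classical
  obtain ⟨S, hS, hA⟩ := hf
  have hf0 : f 0 = 0 := f.map_bot
  have key : ∀ n : ℕ, ∀ x : I, IsDyadic x → (S.filter (· < x)).card ≤ n → IsDyadic (f x) := by
    intro n
    induction n with
    | zero =>
      intro x hx hc
      rcases eq_or_lt_of_le (show (0 : I) ≤ x from bot_le) with h | h
      · rw [← h, hf0]; exact IsDyadic.zero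
      · obtain ⟨k, hk⟩ := hA 0 x h.le (by
          rw [Set.disjoint_left]
          intro y hy hyS
          have : y ∈ S.filter (· < x) := Finset.mem_filter.2 ⟨hyS, hy.2⟩
          rw [Finset.card_eq_zero.1 (Nat.le_zero.1 hc)] at this
          simp at this)
        rw [hk x ⟨h.le, le_rfl⟩, hf0]
        exact IsDyadic.zero.add ((hx.sub IsDyadic.zero).zpow_mul k)
    | succ n ih =>
      intro x hx hc
      by_cases hT : (S.filter (· < x)).Nonempty
      · have hm := (S.filter (· < x)).max'_mem hT
        set s := (S.filter (· < x)).max' hT with hs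
        have hm' := Finset.mem_filter.1 hm
        obtain ⟨k, hk⟩ := hA s x hm'.2.le (by
          rw [Set.disjoint_left]
          intro y hy hyS
          have : y ∈ S.filter (· < x) := Finset.mem_filter.2 ⟨hyS, hy.2⟩
          exact absurd (Finset.le_max' _ y this) (not_le.2 hy.1))
        rw [hk x ⟨hm'.2.le, le_rfl⟩]
        refine (ih s (hS s hm'.1) ?_).add ((hx.sub (hS s hm'.1)).zpow_mul k)
        have hlt : (S.filter (· < s)).card < (S.filter (· < x)).card := by
          apply Finset.card_lt_card
          refine ⟨fun y hy => ?_, fun h => ?_⟩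
          · rw [Finset.mem_filter] at hy ⊢
            exact ⟨hy.1, hy.2.trans hm'.2⟩
          · have := h hm
            simp at this
        omega
      · exact ih x hx (by rw [Finset.not_nonempty_iff_eq_empty.1 hT]; simp)
  exact key _ x hx le_rfl

theorem IsDyadicPL.isDyadic_symm_apply {f : HomeoPlus} (hf : IsDyadicPL f) (y : I)
    (hy : IsDyadic y) : IsDyadic (f.symm y) := by
  obtain ⟨S, hS, hA⟩ := id hf
  obtain ⟨x, rfl⟩ := f.surjective y
  rw [f.symm_apply_apply]
  rcases eq_or_lt_of_le (show (0 : I) ≤ x from bot_le) with h | h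
  · rw [← h]; exact IsDyadic.zero
  · obtain ⟨a, hax, had, hd⟩ := exists_previous S hS x h
    obtain ⟨k, hk⟩ := hA a x hax.le hd
    have h1 := hk x ⟨hax.le, le_rfl⟩
    have h2 : (x : ℝ) = a + 2 ^ (-k) * ((f x : ℝ) - f a) := by
      rw [h1, zpow_neg]
      field_simp
      ring
    rw [h2]
    exact had.add ((hy.sub (hf.isDyadic_apply a had)).zpow_mul _)

theorem IsDyadicPL.one : IsDyadicPL (1 : HomeoPlus) :=
  ⟨∅, by simp, fun a b _ _ => ⟨0, fun x _ => by simp⟩⟩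

theorem IsDyadicPL.mul {g f : HomeoPlus} (hg : IsDyadicPL g) (hf : IsDyadicPL f) :
    IsDyadicPL (g * f : HomeoPlus) := by
  classical
  obtain ⟨S, hS, hA⟩ := id hf
  obtain ⟨T, hT, hB⟩ := id hg
  refine ⟨S ∪ T.image f.symm, ?_, ?_⟩
  · intro s hs
    rcases Finset.mem_union.1 hs with h | h
    · exact hS s h
    · obtain ⟨t, ht, rfl⟩ := Finset.mem_image.1 h
      exact hf.isDyadic_symm_apply t (hT t ht)
  · intro a b hab hd
    rw [Set.disjoint_left] at hd
    obtain ⟨k, hk⟩ := hA a b hab (by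
      rw [Set.disjoint_left]
      exact fun y hy hyS => hd hy (Finset.mem_union_left _ hyS))
    obtain ⟨l, hl⟩ := hB (f a) (f b) (f.monotone hab) (by
      rw [Set.disjoint_left]
      intro y hy hyT
      refine hd (a := f.symm y) ⟨?_, ?_⟩
        (Finset.mem_union_right _ (Finset.mem_image_of_mem _ hyT))
      · exact f.lt_symm_apply.2 hy.1
      · exact f.symm_apply_lt.2 hy.2)
    refine ⟨l + k, fun x hx => ?_⟩
    have h1 := hl (f x) ⟨f.monotone hx.1, f.monotone hx.2⟩
    have h2 := hk x hx
    change (g (f x) : ℝ) = g (f a) + _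
    rw [h1, h2, zpow_add₀ two_ne_zero]
    ring

theorem IsDyadicPL.inv {f : HomeoPlus} (hf : IsDyadicPL f) : IsDyadicPL (f⁻¹ : HomeoPlus) := by
  classical
  obtain ⟨S, hS, hA⟩ := id hf
  refine ⟨S.image f, ?_, ?_⟩
  · intro s hs
    obtain ⟨t, ht, rfl⟩ := Finset.mem_image.1 hs
    exact hf.isDyadic_apply t (hS t ht)
  · intro a b hab hd
    rw [Set.disjoint_left] at hd
    obtain ⟨k, hk⟩ := hA (f.symm a) (f.symm b) (f.symm.monotone hab) (by
      rw [Set.disjoint_left]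
      intro y hy hyS
      refine hd (a := f y) ⟨?_, ?_⟩ (Finset.mem_coe.2 (Finset.mem_image_of_mem _ hyS))
      · exact f.symm_apply_lt.1 hy.1
      · exact f.lt_symm_apply.1 hy.2)
    refine ⟨-k, fun x hx => ?_⟩
    have h1 := hk (f.symm x) ⟨f.symm.monotone hx.1, f.symm.monotone hx.2⟩
    rw [f.apply_symm_apply, f.apply_symm_apply] at h1
    change (f.symm x : ℝ) = f.symm a + _
    rw [h1, zpow_neg]
    field_simp
    ring

/-- Thompson's group `F`: the piecewise linear orientation-preserving homeomorphisms of `[0,1]` whose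
breakpoints are dyadic rational numbers and whose slopes are powers of two. Its inclusion
`ThompsonF.subtype` into `Homeo₊(I)` is the standard piecewise linear action of `F`. -/
def ThompsonF : Subgroup HomeoPlus where
  carrier := {f | IsDyadicPL f}
  one_mem' := IsDyadicPL.one
  mul_mem' := fun {_ _} hf hg => hf.mul hg
  inv_mem' := fun {_} hf => hf.inv

/-- The action `φ` of `G` on `I` is semiconjugate to the action `ψ`: there is a monotone
(non-decreasing or non-increasing), surjective, continuous map `h : I → I` that intertwines them,
`h ∘ φ g = ψ g ∘ h` for all `g`. -/
def IsSemiconjugateTo {G : Type*} [Group G] (φ ψ : G →* HomeoPlus) : Prop :=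
  ∃ h : I → I, (Monotone h ∨ Antitone h) ∧ Surjective h ∧ Continuous h ∧
    ∀ (g : G) (x : I), h (φ g x) = ψ g (h x)

/-- A group is locally indicable if every nontrivial finitely generated subgroup admits a surjective
homomorphism onto `ℤ`. -/
def IsLocallyIndicable (G : Type*) [Group G] : Prop :=
  ∀ H : Subgroup G, H.FG → H ≠ ⊥ → ∃ f : H →* Multiplicative ℤ, Surjective f

/-! Non-embedding. Let `φ` be the restriction to `F` of a `C^1` action of `F * ℤ`, and `t` the image
of the generator of `ℤ`. The aim is to find nontrivial `f, f'` in `F` such that `φ f` and `t (φ f')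
t⁻¹` have disjoint supports, hence commute (`exists_commute_conj`). In `F * ℤ` the corresponding
elements never commute, so the action is not faithful.

Supports are controlled through the semiconjugacies. On an invariant interval where `F` acts
faithfully, the action is semiconjugate to the standard one. Hence two elements of `F` carry some
subinterval into disjoint parts of itself, and one of them contracts it by at least half. On a very
short interval with fixed endpoints a `C^1` diffeomorphism cannot do this, so faithful intervals
have length bounded below (`exists_le_length_of_isFaithfulInterval`). In particular only finitely
many components of the complement of the global fixed points carry a faithful action, with
semiconjugacies `H i`. The same bound, applied to the copy `F_K` of `F` supported on a dyadic
interval `K`, shows that certain commutators in `F_K` move only points of the union of the `H i ⁻¹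
K`: otherwise an element commuting with `F_K` would produce infinitely many disjoint faithful
intervals (`IsFaithfulComponent.map_mem_Icc`). For suitable small `K`, `K'` these unions are
disjoint after applying `t` to the second.

Local indicability. A finitely generated nontrivial subgroup of `F` maps nontrivially to `ℤ` by the
logarithm of the right slope at the infimum of the points that it moves. For `A * ℤ`, a subgroup
either has nontrivial image in `A` or lies in the kernel of the projection to `A`, which embeds in a
free group. -/

/-! ### Copies of `F` supported on dyadic intervals. -/

/-- The affine parametrisation of `[u, v]` by `[0, 1]`. -/
def affineIcc (u v y : I) : I :=
  ⟨u + (v - u) * y, by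
    have h1 := mul_nonneg u.2.1 (sub_nonneg.2 y.2.2)
    have h2 := mul_nonneg v.2.1 y.2.1
    have h3 := mul_le_mul_of_nonneg_right u.2.2 (sub_nonneg.2 y.2.2)
    have h4 := mul_le_mul_of_nonneg_right v.2.2 y.2.1
    constructor <;> linarith⟩

/-- The affine coordinate on `[u, v]`, constant to the left of `u` and to the right of `v`. -/
noncomputable def affineProj (u v x : I) : I :=
  projIcc (0 : ℝ) 1 zero_le_one ((x - u) / (v - u))

theorem coe_affineIcc (u v y : I) : (affineIcc u v y : ℝ) = u + (v - u) * y := rfl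

theorem continuous_affineProj (u v : I) : Continuous (affineProj u v) := by
  refine continuous_projIcc.comp ?_
  fun_prop

section

variable {u v : I}

theorem coe_sub_pos (huv : u < v) : (0 : ℝ) < v - u := sub_pos.2 huv

theorem strictMono_affineIcc (huv : u < v) : StrictMono (affineIcc u v) := by
  intro x y hxy
  have h : (x : ℝ) < y := hxy
  change (_ : ℝ) < _
  rw [coe_affineIcc, coe_affineIcc]
  have := mul_lt_mul_of_pos_left h (coe_sub_pos huv)
  linarith

theorem monotone_affineProj (huv : u < v) : Monotone (affineProj u v) := by
  intro x y hxy
  have h : (x : ℝ) ≤ y := hxy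
  refine monotone_projIcc _ ?_
  exact div_le_div_of_nonneg_right (by linarith) (coe_sub_pos huv).le

theorem affineIcc_zero : affineIcc u v 0 = u := Subtype.ext (by simp [coe_affineIcc])

theorem affineIcc_one : affineIcc u v 1 = v := Subtype.ext (by simp [coe_affineIcc])

theorem affineIcc_mem (huv : u < v) (y : I) : affineIcc u v y ∈ Icc u v := by
  have h := (strictMono_affineIcc huv).monotone
  exact ⟨affineIcc_zero.symm.le.trans (h bot_le), (h le_top).trans affineIcc_one.le⟩

theorem affineProj_affineIcc (huv : u < v) (y : I) : affineProj u v (affineIcc u v y) = y := by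
  have h : ((affineIcc u v y : ℝ) - u) / (v - u) = y := by
    have := coe_sub_pos huv
    rw [coe_affineIcc]
    field_simp
    ring
  rw [affineProj, h, projIcc_val]

theorem affineIcc_affineProj (huv : u < v) {x : I} (hx : x ∈ Icc u v) :
    affineIcc u v (affineProj u v x) = x := by
  have hp := coe_sub_pos huv
  have h1 : (u : ℝ) ≤ x := hx.1
  have h2 : (x : ℝ) ≤ v := hx.2
  refine Subtype.ext ?_
  rw [coe_affineIcc, affineProj, projIcc_of_mem _ (x := ((x : ℝ) - u) / (v - u))
    ⟨div_nonneg (by linarith) hp.le, (div_le_one hp).2 (by linarith)⟩]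
  field_simp
  ring

theorem affineProj_left : affineProj u v u = 0 := by
  simp [affineProj]

theorem affineProj_right (huv : u < v) : affineProj u v v = 1 := by
  have := coe_sub_pos huv
  simp [affineProj, div_self this.ne']

/-- The map acting as `f` on `[u, v]`, in the affine coordinate, and trivially elsewhere. -/
noncomputable def extendMap (u v : I) (f : I → I) (x : I) : I :=
  if x ∈ Icc u v then affineIcc u v (f (affineProj u v x)) else x

theorem extendMap_of_mem {f : I → I} {x : I} (hx : x ∈ Icc u v) :
    extendMap u v f x = affineIcc u v (f (affineProj u v x)) := if_pos hx

theorem extendMap_of_notMem {f : I → I} {x : I} (hx : x ∉ Icc u v) :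
    extendMap u v f x = x := if_neg hx

theorem extendMap_affineIcc (huv : u < v) (f : I → I) (y : I) :
    extendMap u v f (affineIcc u v y) = affineIcc u v (f y) := by
  rw [extendMap_of_mem (affineIcc_mem huv y), affineProj_affineIcc huv]

theorem extendMap_comp (huv : u < v) (f g : I → I) (x : I) :
    extendMap u v f (extendMap u v g x) = extendMap u v (f ∘ g) x := by
  by_cases hx : x ∈ Icc u v
  · rw [extendMap_of_mem hx, extendMap_affineIcc huv, extendMap_of_mem hx]
    rfl
  · rw [extendMap_of_notMem hx, extendMap_of_notMem hx, extendMap_of_notMem hx]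

theorem extendMap_id (huv : u < v) (x : I) : extendMap u v (fun y => y) x = x := by
  by_cases hx : x ∈ Icc u v
  · rw [extendMap_of_mem hx, affineIcc_affineProj huv hx]
  · rw [extendMap_of_notMem hx]

theorem monotone_extendMap (huv : u < v) {f : I → I} (hf : Monotone f) :
    Monotone (extendMap u v f) := by
  intro x y hxy
  by_cases hx : x ∈ Icc u v <;> by_cases hy : y ∈ Icc u v
  · rw [extendMap_of_mem hx, extendMap_of_mem hy]
    exact (strictMono_affineIcc huv).monotone (hf (monotone_affineProj huv hxy))
  · rw [extendMap_of_mem hx, extendMap_of_notMem hy]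
    refine (affineIcc_mem huv _).2.trans (not_lt.1 fun h => hy ⟨hx.1.trans hxy, h.le⟩)
  · rw [extendMap_of_notMem hx, extendMap_of_mem hy]
    refine le_trans (not_lt.1 fun h => hx ⟨h.le, hxy.trans hy.2⟩) (affineIcc_mem huv _).1
  · rw [extendMap_of_notMem hx, extendMap_of_notMem hy]
    exact hxy

/-- `Homeo₊(I)` acting on `[u, v]`, in the affine coordinate, and trivially elsewhere. -/
noncomputable def extendHom (huv : u < v) : HomeoPlus →* HomeoPlus where
  toFun f := Equiv.toOrderIso
    { toFun := extendMap u v f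
      invFun := extendMap u v f.symm
      left_inv := fun x => by
        rw [extendMap_comp huv]
        simpa [Function.comp_def] using extendMap_id huv x
      right_inv := fun x => by
        rw [extendMap_comp huv]
        simpa [Function.comp_def] using extendMap_id huv x }
    (monotone_extendMap huv f.monotone) (monotone_extendMap huv f.symm.monotone)
  map_one' := RelIso.ext fun x => extendMap_id huv x
  map_mul' f g := RelIso.ext fun x => (extendMap_comp huv f g x).symm

theorem extendHom_apply (huv : u < v) (f : HomeoPlus) (x : I) :
    extendHom huv f x = extendMap u v f x := rfl

/-- Conjugation by an affine map preserves slopes. The breakpoints become `u + 2 ^ (-n) * s`,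
together with `u` and `v`; they stay dyadic because the length is a power of two. -/
theorem isDyadicPL_extendHom (huv : u < v) (hu : IsDyadic u) {n : ℕ}
    (hn : (v : ℝ) - u = 2 ^ (-(n : ℤ))) {f : HomeoPlus} (hf : IsDyadicPL f) :
    IsDyadicPL (extendHom huv f) := by
  classical
  obtain ⟨S, hS, hA⟩ := hf
  refine ⟨insert u (insert v (S.image (affineIcc u v))), ?_, ?_⟩
  · intro s hs
    simp only [Finset.mem_insert, Finset.mem_image] at hs
    rcases hs with rfl | rfl | ⟨t, ht, rfl⟩
    · exact hu
    · have : (s : ℝ) = u + 2 ^ (-(n : ℤ)) * 1 := by rw [mul_one, ← hn]; ring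
      rw [this]
      exact hu.add (IsDyadic.zpow_mul ⟨1, 0, by simp⟩ _)
    · rw [coe_affineIcc, hn]
      exact hu.add ((hS t ht).zpow_mul _)
  · intro a b hab hd
    rw [Set.disjoint_left] at hd
    simp only [Finset.coe_insert, Finset.coe_image, Set.mem_insert_iff, not_or] at hd
    have hou : ¬ (a < u ∧ u < b) := fun h => (hd h).1 rfl
    have hov : ¬ (a < v ∧ v < b) := fun h => (hd h).2.1 rfl
    rcases eq_or_lt_of_le hab with rfl | hlt
    · exact ⟨0, fun x hx => by rw [le_antisymm hx.2 hx.1]; simp⟩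
    by_cases hin : u ≤ a ∧ b ≤ v
    · obtain ⟨k, hk⟩ := hA (affineProj u v a) (affineProj u v b) (monotone_affineProj huv hab) (by
        rw [Set.disjoint_left]
        intro y hy hyS
        refine (hd (a := affineIcc u v y) ⟨?_, ?_⟩).2.2 ⟨y, hyS, rfl⟩
        · have := strictMono_affineIcc huv hy.1
          rwa [affineIcc_affineProj huv ⟨hin.1, hab.trans hin.2⟩] at this
        · have := strictMono_affineIcc huv hy.2
          rwa [affineIcc_affineProj huv ⟨hin.1.trans hab, hin.2⟩] at this)
      refine ⟨k, fun x hx => ?_⟩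
      have hxm : x ∈ Icc u v := ⟨hin.1.trans hx.1, hx.2.trans hin.2⟩
      have ham : a ∈ Icc u v := ⟨hin.1, hab.trans hin.2⟩
      have h1 := hk (affineProj u v x) ⟨monotone_affineProj huv hx.1, monotone_affineProj huv hx.2⟩
      have h2 := congrArg (Subtype.val) (affineIcc_affineProj huv hxm)
      have h3 := congrArg (Subtype.val) (affineIcc_affineProj huv ham)
      rw [coe_affineIcc] at h2 h3
      rw [extendHom_apply, extendHom_apply, extendMap_of_mem hxm, extendMap_of_mem ham,
        coe_affineIcc, coe_affineIcc, h1, ← h2, ← h3, h2, h3]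
      linear_combination (2 : ℝ) ^ k * (h2 - h3)
    -- Neither `u` nor `v` is interior to `[a, b]`, so `[a, b]` meets `[u, v]` at most in an
    -- endpoint, which is fixed.
    · have key : ∀ x ∈ Icc a b, extendMap u v f x = x := by
        have hf0 : f 0 = 0 := f.map_bot
        have hf1 : f 1 = 1 := f.map_top
        intro x hx
        by_cases hxm : x ∈ Icc u v
        · rw [extendMap_of_mem hxm]
          by_cases hua : u ≤ a
          · have hvb : v < b := not_le.1 fun h => hin ⟨hua, h⟩
            have hva : v ≤ a := not_lt.1 fun h => hov ⟨h, hvb⟩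
            have hxv : x = v := le_antisymm hxm.2 (hva.trans hx.1)
            rw [hxv, affineProj_right huv, hf1, affineIcc_one]
          · have hbu : b ≤ u := not_lt.1 fun h => hou ⟨not_le.1 hua, h⟩
            have hxu : x = u := le_antisymm (hx.2.trans hbu) hxm.1
            rw [hxu, affineProj_left, hf0, affineIcc_zero]
        · exact extendMap_of_notMem hxm
      refine ⟨0, fun x hx => ?_⟩
      rw [extendHom_apply, extendHom_apply, key x hx, key a ⟨le_rfl, hab⟩]
      simp

end

/-- `[u, v]` is a subinterval with dyadic endpoints whose length is a power of two. -/
structure IsDyadicInterval (u v : I) : Prop where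
  lt : u < v
  left : IsDyadic u
  length : ∃ n : ℕ, (v : ℝ) - u = 2 ^ (-(n : ℤ))

section

variable {u v : I}

/-- The copy of Thompson's group supported on a dyadic interval. -/
noncomputable def thompsonExtend (h : IsDyadicInterval u v) : ThompsonF →* ThompsonF :=
  ((extendHom h.lt).comp ThompsonF.subtype).codRestrict ThompsonF fun f =>
    let ⟨_, hn⟩ := h.length
    isDyadicPL_extendHom h.lt h.left hn f.2

theorem thompsonExtend_affineIcc (h : IsDyadicInterval u v) (f : ThompsonF) (y : I) :
    (thompsonExtend h f : HomeoPlus) (affineIcc u v y) = affineIcc u v ((f : HomeoPlus) y) :=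
  extendMap_affineIcc h.lt _ y

theorem thompsonExtend_left (h : IsDyadicInterval u v) (f : ThompsonF) :
    (thompsonExtend h f : HomeoPlus) u = u := by
  have := thompsonExtend_affineIcc h f 0
  rwa [show (f : HomeoPlus) 0 = 0 from (f : HomeoPlus).map_bot, affineIcc_zero] at this

theorem thompsonExtend_right (h : IsDyadicInterval u v) (f : ThompsonF) :
    (thompsonExtend h f : HomeoPlus) v = v := by
  have := thompsonExtend_affineIcc h f 1
  rwa [show (f : HomeoPlus) 1 = 1 from (f : HomeoPlus).map_top, affineIcc_one] at this

theorem thompsonExtend_of_notMem (h : IsDyadicInterval u v) (f : ThompsonF) {x : I}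
    (hx : x ∉ Ioo u v) : (thompsonExtend h f : HomeoPlus) x = x := by
  by_cases hxm : x ∈ Icc u v
  · rcases eq_or_lt_of_le hxm.1 with rfl | h1
    · exact thompsonExtend_left h f
    · have : x = v := le_antisymm hxm.2 (not_lt.1 fun h2 => hx ⟨h1, h2⟩)
      rw [this, thompsonExtend_right h f]
  · exact extendMap_of_notMem hxm

theorem thompsonExtend_injective (h : IsDyadicInterval u v) : Injective (thompsonExtend h) := by
  intro f g hfg
  refine Subtype.ext (RelIso.ext fun y => (strictMono_affineIcc h.lt).injective ?_)
  change affineIcc u v ((f : HomeoPlus) y) = affineIcc u v ((g : HomeoPlus) y)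
  rw [← thompsonExtend_affineIcc h, ← thompsonExtend_affineIcc h, hfg]

end

/-! ### A generator of `F` and the compression of intervals. -/

/-- The generator of Thompson's group with slopes `2`, `1` and `1/2`, as a homeomorphism. -/
noncomputable def generatorHomeo : HomeoPlus := Equiv.toOrderIso
  { toFun := fun x => ⟨min (2 * (x : ℝ)) (min (x + 1 / 4) ((x + 1) / 2)), by
      obtain ⟨x, hx, hx'⟩ := x
      constructor
      · simp only [le_min_iff]; refine ⟨?_, ?_, ?_⟩ <;> linarith
      · exact (min_le_right _ _).trans ((min_le_right _ _).trans (by dsimp only; linarith))⟩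
    invFun := fun y => ⟨max ((y : ℝ) / 2) (max (y - 1 / 4) (2 * y - 1)), by
      obtain ⟨y, hy, hy'⟩ := y
      constructor
      · exact le_trans (by dsimp only; linarith) (le_max_left _ _)
      · simp only [max_le_iff]; refine ⟨?_, ?_, ?_⟩ <;> linarith⟩
    left_inv := fun x => Subtype.ext (by
      obtain ⟨x, hx, hx'⟩ := x
      dsimp only
      grind)
    right_inv := fun x => Subtype.ext (by
      obtain ⟨x, hx, hx'⟩ := x
      dsimp only
      grind) }
  (fun x y hxy => by
    have h : (x : ℝ) ≤ y := hxy
    change min (2 * (x : ℝ)) (min (x + 1 / 4) ((x + 1) / 2)) ≤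
      min (2 * (y : ℝ)) (min (y + 1 / 4) ((y + 1) / 2))
    gcongr)
  (fun x y hxy => by
    have h : (x : ℝ) ≤ y := hxy
    change max ((x : ℝ) / 2) (max (x - 1 / 4) (2 * x - 1)) ≤
      max ((y : ℝ) / 2) (max (y - 1 / 4) (2 * y - 1))
    gcongr)

theorem coe_generatorHomeo (x : I) :
    (generatorHomeo x : ℝ) = min (2 * (x : ℝ)) (min (x + 1 / 4) ((x + 1) / 2)) := rfl

theorem isDyadicPL_generatorHomeo : IsDyadicPL generatorHomeo := by
  classical
  refine ⟨{⟨1 / 4, by norm_num⟩, ⟨1 / 2, by norm_num⟩}, ?_, ?_⟩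
  · intro s hs
    simp only [Finset.mem_insert, Finset.mem_singleton] at hs
    rcases hs with rfl | rfl
    · exact ⟨1, 2, by norm_num⟩
    · exact ⟨1, 1, by norm_num⟩
  · intro a b hab hd
    rw [Set.disjoint_left] at hd
    simp only [Finset.coe_insert, Finset.coe_singleton, Set.mem_insert_iff, Set.mem_singleton_iff,
      not_or] at hd
    have h1 : ¬ ((a : ℝ) < 1 / 4 ∧ (1 / 4 : ℝ) < b) := fun h => (hd (a := ⟨1 / 4, by norm_num⟩) h).1 rfl
    have h2 : ¬ ((a : ℝ) < 1 / 2 ∧ (1 / 2 : ℝ) < b) := fun h => (hd (a := ⟨1 / 2, by norm_num⟩) h).2 rfl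
    have hab' : (a : ℝ) ≤ b := hab
    unfold AffineTwoPow
    by_cases hb : (b : ℝ) ≤ 1 / 4
    · refine ⟨1, fun x ⟨hx1, hx2⟩ => ?_⟩
      have hx1 : (a : ℝ) ≤ x := hx1
      have hx2 : (x : ℝ) ≤ b := hx2
      rw [coe_generatorHomeo, coe_generatorHomeo, zpow_one]
      grind
    by_cases ha : (1 / 2 : ℝ) ≤ a
    · refine ⟨-1, fun x ⟨hx1, hx2⟩ => ?_⟩
      have hx1 : (a : ℝ) ≤ x := hx1
      have hx2 : (x : ℝ) ≤ b := hx2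
      rw [coe_generatorHomeo, coe_generatorHomeo, zpow_neg, zpow_one]
      grind
    by_cases hba : (a : ℝ) = b
    · refine ⟨0, fun x ⟨hx1, hx2⟩ => ?_⟩
      rw [show x = a from le_antisymm (hx2.trans (Subtype.ext hba).symm.le) hx1]
      simp
    · refine ⟨0, fun x ⟨hx1, hx2⟩ => ?_⟩
      have hx1 : (a : ℝ) ≤ x := hx1
      have hx2 : (x : ℝ) ≤ b := hx2
      rw [coe_generatorHomeo, coe_generatorHomeo, zpow_zero]
      grind

/-- The generator of Thompson's group with slopes `2`, `1` and `1/2`. -/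
noncomputable def thompsonGenerator : ThompsonF := ⟨generatorHomeo, isDyadicPL_generatorHomeo⟩

theorem lt_thompsonGenerator_apply {x : I} (h0 : 0 < x) (h1 : x < 1) :
    x < (thompsonGenerator : HomeoPlus) x := by
  have h0 : (0 : ℝ) < x := h0
  have h1 : (x : ℝ) < 1 := h1
  change (x : ℝ) < min (2 * (x : ℝ)) (min (x + 1 / 4) ((x + 1) / 2))
  simp only [lt_min_iff]
  refine ⟨?_, ?_, ?_⟩ <;> linarith

theorem HomeoPlus.map_zero (f : HomeoPlus) : f 0 = 0 := f.map_bot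

theorem HomeoPlus.map_one (f : HomeoPlus) : f 1 = 1 := f.map_top

theorem HomeoPlus.commute_of_disjoint {f g : HomeoPlus} (h : ∀ x, f x = x ∨ g x = x) :
    Commute f g := by
  refine RelIso.ext fun x => ?_
  change f (g x) = g (f x)
  rcases h x with hx | hx
  · rcases h (g x) with hgx | hgx
    · rw [hgx, hx]
    · rw [g.injective hgx, hx, g.injective hgx]
  · rcases h (f x) with hfx | hfx
    · rw [f.injective hfx, hx, f.injective hfx]
    · rw [hx, hfx]

/-- The supremum of a bounded forward orbit would be pushed further by `g`, so some orbit point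
would exceed it. -/
theorem HomeoPlus.exists_lt_pow_apply {g : HomeoPlus} (hg : ∀ x, 0 < x → x < 1 → x < g x) {x y : I}
    (hx : 0 < x) (hy : y < 1) : ∃ k : ℕ, y < (g ^ k) x := by
  by_contra! hcon
  set L : I := ⨆ k : ℕ, (g ^ k) x with hL
  have hxL : x ≤ L := le_iSup (fun k : ℕ => (g ^ k) x) 0
  have hLy : L ≤ y := iSup_le hcon
  have h1 : g.symm L < L := g.symm_apply_lt.2 (hg L (hx.trans_le hxL) (hLy.trans_lt hy))
  obtain ⟨k, hk⟩ := lt_iSup_iff.1 h1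
  have h2 : L < (g ^ (k + 1)) x := by
    rw [pow_succ', RelIso.mul_apply]
    exact g.symm_apply_lt.1 hk
  exact absurd (le_iSup (fun k : ℕ => (g ^ k) x) (k + 1)) (not_le.2 h2)

theorem exists_lt_thompsonGenerator_pow {x y : I} (hx : 0 < x) (hy : y < 1) :
    ∃ k : ℕ, y < ((thompsonGenerator ^ k : ThompsonF) : HomeoPlus) x :=
  HomeoPlus.exists_lt_pow_apply (fun _ => lt_thompsonGenerator_apply) hx hy

theorem exists_isDyadicInterval {a q b : I} (ha : a < q) (hb : q < b) :
    ∃ u v : I, IsDyadicInterval u v ∧ a < u ∧ u < q ∧ q < v ∧ v < b := by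
  have ha' : (a : ℝ) < q := ha
  have hb' : (q : ℝ) < b := hb
  -- The interval is made of two cells of mesh `2 ^ (-(k + 1))`, so that `q` is interior even when
  -- it is a mesh point; its length `2 ^ (-k)` is smaller than both distances from `q`.
  obtain ⟨k, hk⟩ := exists_pow_lt_of_lt_one (lt_min (sub_pos.2 ha') (sub_pos.2 hb'))
    (show (1 / 2 : ℝ) < 1 by norm_num)
  rw [lt_min_iff] at hk
  set m : ℤ := ⌈(2 : ℝ) ^ (k + 1) * q⌉
  have h1 : (2 : ℝ) ^ (k + 1) * q ≤ m := Int.le_ceil _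
  have h2 : (m : ℝ) < (2 : ℝ) ^ (k + 1) * q + 1 := Int.ceil_lt_add_one _
  have hp : (0 : ℝ) < 2 ^ (k + 1) := by positivity
  have hw : (1 / 2 : ℝ) ^ k = 2 / 2 ^ (k + 1) := by
    rw [one_div, inv_pow, pow_succ]; field_simp
  have e1 : (a : ℝ) < (m - 1) / 2 ^ (k + 1) := by
    have h3 := hk.1
    rw [hw, div_lt_iff₀ hp] at h3
    rw [lt_div_iff₀ hp]
    linarith
  have e2 : (m - 1) / 2 ^ (k + 1) < (q : ℝ) := by
    rw [div_lt_iff₀ hp]; linarith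
  have e3 : (q : ℝ) < (m + 1) / 2 ^ (k + 1) := by
    rw [lt_div_iff₀ hp]; linarith
  have e4 : (m + 1) / 2 ^ (k + 1) < (b : ℝ) := by
    have h3 := hk.2
    rw [hw, div_lt_iff₀ hp] at h3
    rw [div_lt_iff₀ hp]
    linarith
  refine ⟨⟨(m - 1) / 2 ^ (k + 1), a.2.1.trans e1.le, e2.le.trans q.2.2⟩,
    ⟨(m + 1) / 2 ^ (k + 1), q.2.1.trans e3.le, e4.le.trans b.2.2⟩,
    ⟨e2.trans e3, ⟨m - 1, k + 1, by push_cast; rfl⟩, k, ?_⟩, e1, e2, e3, e4⟩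
  dsimp only
  rw [zpow_neg, zpow_natCast]
  field_simp
  ring

/-- A negative power of the generator brings `[a, b]` into the first cell of mesh `2 ^ (-n)`. To go
from one cell to the next, a power of the copy of the generator on the union of the two cells pushes
the interval past their common endpoint. -/
theorem exists_thompson_compress_dyadic {a b : I} (ha : 0 < a) (hab : a ≤ b) (hb : b < 1) (n m : ℕ)
    (hm : m + 1 ≤ 2 ^ n) : ∃ g : ThompsonF, (m / 2 ^ n : ℝ) < (g : HomeoPlus) a ∧
      ((g : HomeoPlus) b : ℝ) < (m + 1) / 2 ^ n := by
  have hp : (0 : ℝ) < 2 ^ n := by positivity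
  induction m with
  | zero =>
    have h1 : (1 / 2 ^ n : ℝ) ∈ I :=
      ⟨by positivity, (div_le_one hp).2 (one_le_pow₀ (by norm_num))⟩
    obtain ⟨k, hk⟩ := exists_lt_thompsonGenerator_pow (x := ⟨1 / 2 ^ n, h1⟩) (y := b)
      (show (0 : ℝ) < 1 / 2 ^ n by positivity) hb
    refine ⟨(thompsonGenerator ^ k)⁻¹, ?_, ?_⟩
    · have h2 : (0 : I) < ((thompsonGenerator ^ k : ThompsonF) : HomeoPlus).symm a := by
        rw [OrderIso.lt_symm_apply, HomeoPlus.map_zero]; exact ha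
      rw [Nat.cast_zero, zero_div]
      exact h2
    · have h2 := OrderIso.symm_apply_lt _ |>.2 hk
      rw [Nat.cast_zero, zero_add]
      exact h2
  | succ m ih =>
    obtain ⟨g, hg1, hg2⟩ := ih (by omega)
    have hm' : ((m : ℝ) + 1 + 1) ≤ 2 ^ n := by exact_mod_cast hm
    -- Two cells together have length `2 ^ (-(n - 1))`, which requires `n` positive.
    have hn : n ≠ 0 := by rintro rfl; omega
    obtain ⟨j, rfl⟩ := Nat.exists_eq_succ_of_ne_zero hn
    set u : I := ⟨m / 2 ^ (j + 1), by positivity, (div_le_one hp).2 (by linarith)⟩ with hu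
    set v : I := ⟨(m + 1 + 1) / 2 ^ (j + 1), by positivity, (div_le_one hp).2 (by linarith)⟩ with hv
    have hvu : (v : ℝ) - u = 2 / 2 ^ (j + 1) := by rw [hu, hv]; ring
    have hD : IsDyadicInterval u v := by
      refine ⟨?_, ⟨m, j + 1, by simp [hu]⟩, j, ?_⟩
      · have : (0 : ℝ) < v - u := by rw [hvu]; positivity
        exact Subtype.coe_lt_coe.1 (sub_pos.1 this)
      · rw [hvu, zpow_neg, zpow_natCast, pow_succ]
        field_simp
    have hmid : (affineIcc u v ⟨1 / 2, by norm_num⟩ : ℝ) = (m + 1) / 2 ^ (j + 1) := by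
      rw [coe_affineIcc, hvu, hu]
      ring
    have hga : u < (g : HomeoPlus) a := hg1
    have hgb : (g : HomeoPlus) b < affineIcc u v ⟨1 / 2, by norm_num⟩ := by
      change (_ : ℝ) < _
      rw [hmid]; exact hg2
    have hgab : (g : HomeoPlus) a ≤ (g : HomeoPlus) b := (g : HomeoPlus).monotone hab
    have hmv := (affineIcc_mem hD.lt ⟨1 / 2, by norm_num⟩).2
    set y := affineProj u v ((g : HomeoPlus) a) with hy
    have hyg : affineIcc u v y = (g : HomeoPlus) a :=
      affineIcc_affineProj hD.lt ⟨hga.le, hgab.trans (hgb.le.trans hmv)⟩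
    have hy0 : 0 < y := by
      rw [← (strictMono_affineIcc hD.lt).lt_iff_lt, affineIcc_zero, hyg]; exact hga
    obtain ⟨k, hk⟩ := exists_lt_thompsonGenerator_pow hy0
      (show (⟨1 / 2, by norm_num⟩ : I) < 1 from show (1 / 2 : ℝ) < 1 by norm_num)
    refine ⟨thompsonExtend hD (thompsonGenerator ^ k) * g, ?_, ?_⟩
    · have := strictMono_affineIcc hD.lt hk
      rw [← thompsonExtend_affineIcc hD, hyg] at this
      push_cast
      rw [← hmid]
      exact this
    · have : (thompsonExtend hD (thompsonGenerator ^ k) : HomeoPlus) ((g : HomeoPlus) b) < v := by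
        refine lt_of_lt_of_eq ?_ (thompsonExtend_right hD (thompsonGenerator ^ k))
        exact (OrderIso.strictMono _) (hgb.trans_le hmv)
      push_cast
      exact this

theorem exists_thompson_compress {a b α β : I} (ha : 0 < a) (hab : a ≤ b) (hb : b < 1)
    (hαβ : α < β) :
    ∃ g : ThompsonF, α < (g : HomeoPlus) a ∧ (g : HomeoPlus) b < β := by
  have h0 : (α : ℝ) < β := hαβ
  -- A mesh below half of `β - α` leaves a whole cell inside `[α, β]`.
  obtain ⟨n, hn⟩ := exists_pow_lt_of_lt_one (half_pos (sub_pos.2 h0))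
    (show (1 / 2 : ℝ) < 1 by norm_num)
  have hp : (0 : ℝ) < 2 ^ n := by positivity
  rw [one_div, inv_pow, inv_lt_iff_one_lt_mul₀ hp] at hn
  set m : ℕ := ⌈(2 : ℝ) ^ n * α⌉₊
  have h1 : (2 : ℝ) ^ n * α ≤ m := Nat.le_ceil _
  have h2 : (m : ℝ) < (2 : ℝ) ^ n * α + 1 := Nat.ceil_lt_add_one (mul_nonneg hp.le α.2.1)
  have h3 : ((m : ℝ) + 1) < 2 ^ n * β := by linarith
  have h4 : (2 : ℝ) ^ n * β ≤ 2 ^ n := by nlinarith [β.2.2]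
  obtain ⟨g, hg1, hg2⟩ := exists_thompson_compress_dyadic ha hab hb n m
    (by exact_mod_cast (h3.le.trans h4))
  refine ⟨g, ?_, ?_⟩
  · refine lt_of_le_of_lt (b := (m / 2 ^ n : ℝ)) ?_ hg1
    rw [le_div_iff₀ hp]; linarith
  · refine lt_of_lt_of_le (b := ((m + 1) / 2 ^ n : ℝ)) hg2 ?_
    rw [div_le_iff₀ hp]; linarith

/-! ### Compactly supported elements and normal subgroups of `F`. -/

/-- `f` is the identity near the endpoints of `I`. -/
def IsCompactlySupported (f : ThompsonF) : Prop :=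
  ∃ a b : I, 0 < a ∧ a ≤ b ∧ b < 1 ∧ ∀ x, x ∉ Ioo a b → (f : HomeoPlus) x = x

theorem IsCompactlySupported.thompsonExtend {u v : I} (h : IsDyadicInterval u v) {f : ThompsonF}
    (hf : IsCompactlySupported f) : IsCompactlySupported (thompsonExtend h f) := by
  obtain ⟨a, b, ha, hab, hb, hf⟩ := hf
  have hm := strictMono_affineIcc h.lt
  refine ⟨affineIcc u v a, affineIcc u v b, ?_, hm.monotone hab, ?_, fun x hx => ?_⟩
  · have := hm ha
    rw [affineIcc_zero] at this
    exact lt_of_le_of_lt bot_le this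
  · have := hm hb
    rw [affineIcc_one] at this
    exact this.trans_le le_top
  · by_cases hxm : x ∈ Icc u v
    · obtain ⟨y, rfl⟩ : ∃ y, affineIcc u v y = x := ⟨_, affineIcc_affineProj h.lt hxm⟩
      rw [thompsonExtend_affineIcc, hf]
      exact fun hy => hx ⟨hm hy.1, hm hy.2⟩
    · exact thompsonExtend_of_notMem h f fun hx' => hxm ⟨hx'.1.le, hx'.2.le⟩

theorem ThompsonF.ext {f g : ThompsonF} (h : ∀ x, (f : HomeoPlus) x = (g : HomeoPlus) x) : f = g :=
  Subtype.ext (RelIso.ext h)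

theorem ThompsonF.exists_apply_ne {f : ThompsonF} (hf : f ≠ 1) : ∃ x, (f : HomeoPlus) x ≠ x := by
  by_contra! h
  exact hf (ThompsonF.ext h)

theorem ThompsonF.commute_of_disjoint {f g : ThompsonF}
    (h : ∀ x, (f : HomeoPlus) x = x ∨ (g : HomeoPlus) x = x) : Commute f g :=
  Subtype.ext (HomeoPlus.commute_of_disjoint h)

/-- The double commutator trick. Some `n` in `N` moves an interval `(α, β)` off itself; conjugating,
the supports of `f` and `g` may be taken inside it. Then `n f⁻¹ n⁻¹` commutes with `g`, so `[f, g] =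
[[f, n], g]`, which lies in `N`. -/
theorem ThompsonF.commutator_mem_of_normal {N : Subgroup ThompsonF} (hN : N.Normal) (hN1 : N ≠ ⊥)
    {f g : ThompsonF} (hf : IsCompactlySupported f) (hg : IsCompactlySupported g) :
    f * g * f⁻¹ * g⁻¹ ∈ N := by
  obtain ⟨n, hnN, hn⟩ : ∃ n ∈ N, ∃ x, x < (n : HomeoPlus) x := by
    obtain ⟨n, hnN, hn1⟩ := N.bot_or_exists_ne_one.resolve_left hN1
    obtain ⟨x, hx⟩ := ThompsonF.exists_apply_ne hn1
    rcases lt_or_gt_of_ne hx with h | h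
    · exact ⟨n⁻¹, N.inv_mem hnN, x,
        (OrderIso.lt_symm_apply (n : HomeoPlus)).2 h⟩
    · exact ⟨n, hnN, x, h⟩
  obtain ⟨α, hα⟩ := hn
  obtain ⟨β, hαβ, hβ⟩ := exists_between hα
  obtain ⟨a, b, ha, hab, hb, hf⟩ := hf
  obtain ⟨a', b', ha', hab', hb', hg⟩ := hg
  obtain ⟨c, hc1, hc2⟩ := exists_thompson_compress (lt_min ha ha')
    ((min_le_left _ _).trans (hab.trans (le_max_left b b'))) (max_lt hb hb') hαβ
  have hconj : ∀ (k : ThompsonF) (p q : I), min a a' ≤ p → q ≤ max b b' →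
      (∀ x, x ∉ Ioo p q → (k : HomeoPlus) x = x) →
      ∀ x, x ∉ Ioo α β → ((c * k * c⁻¹ : ThompsonF) : HomeoPlus) x = x := by
    intro k p q hp hq hk x hx
    change (c : HomeoPlus) ((k : HomeoPlus) ((c : HomeoPlus).symm x)) = x
    rw [hk, OrderIso.apply_symm_apply]
    intro hx'
    refine hx ⟨hc1.trans ?_, lt_trans ?_ hc2⟩
    · exact (c : HomeoPlus).lt_symm_apply.1 (hp.trans_lt hx'.1)
    · exact (c : HomeoPlus).symm_apply_lt.1 (hx'.2.trans_le hq)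
  have hf' := hconj f a b (min_le_left _ _) (le_max_left _ _) hf
  have hg' := hconj g a' b' (min_le_right _ _) (le_max_right _ _) hg
  set f' := c * f * c⁻¹ with hfdef
  set g' := c * g * c⁻¹ with hgdef
  set k := n * f'⁻¹ * n⁻¹ with hk
  have hkg : Commute k g' := by
    refine ThompsonF.commute_of_disjoint fun x => ?_
    by_cases hx : x ∈ Ioo α β
    · left
      change (n : HomeoPlus) ((f' : HomeoPlus).symm ((n : HomeoPlus).symm x)) = x
      have : (f' : HomeoPlus) ((n : HomeoPlus).symm x) = (n : HomeoPlus).symm x := by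
        refine hf' _ fun hx' => ?_
        have h1 := (n : HomeoPlus).lt_symm_apply.1 hx'.1
        exact absurd (hx.2.trans hβ) (not_lt.2 h1.le)
      rw [(OrderIso.symm_apply_eq _).2 this.symm, OrderIso.apply_symm_apply]
    · exact Or.inr (hg' x hx)
  have hmem : f' * k ∈ N := by
    have := N.mul_mem (hN.conj_mem n hnN f') (N.inv_mem hnN)
    simpa [hk, mul_assoc] using this
  have h1 : f' * k * (g' * (f' * k)⁻¹ * g'⁻¹) ∈ N :=
    N.mul_mem hmem (hN.conj_mem _ (N.inv_mem hmem) g')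
  have h2 : f' * k * (g' * (f' * k)⁻¹ * g'⁻¹) = c * (f * g * f⁻¹ * g⁻¹) * c⁻¹ := by
    have h3 : k * g' * k⁻¹ = g' := by rw [hkg.eq, mul_inv_cancel_right]
    calc f' * k * (g' * (f' * k)⁻¹ * g'⁻¹) = f' * (k * g' * k⁻¹) * f'⁻¹ * g'⁻¹ := by group
      _ = c * (f * g * f⁻¹ * g⁻¹) * c⁻¹ := by rw [h3, hfdef, hgdef]; group
  rw [h2] at h1
  have h4 := hN.conj_mem _ h1 c⁻¹
  simpa [mul_assoc] using h4

theorem lt_thompsonExtend_generator {u v : I} (h : IsDyadicInterval u v) {x : I} (hux : u < x)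
    (hxv : x < v) : x < (thompsonExtend h thompsonGenerator : HomeoPlus) x := by
  obtain ⟨y, rfl⟩ : ∃ y, affineIcc u v y = x :=
    ⟨_, affineIcc_affineProj h.lt ⟨hux.le, hxv.le⟩⟩
  have hm := strictMono_affineIcc h.lt
  rw [thompsonExtend_affineIcc]
  refine hm (lt_thompsonGenerator_apply ?_ ?_)
  · rwa [← hm.lt_iff_lt, affineIcc_zero]
  · rwa [← hm.lt_iff_lt, affineIcc_one]

/-- Take `f` moving `p` upwards and `g` moving `p` with support so close to `p` that it misses `f
p`. If they commuted, `f (g p) = g (f p) = f p` would force `g p = p`. -/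
theorem ThompsonF.exists_commutator_ne_one : ∃ f g : ThompsonF,
    IsCompactlySupported f ∧ IsCompactlySupported g ∧ f * g * f⁻¹ * g⁻¹ ≠ 1 := by
  have key : ∀ {u v : I} (h : IsDyadicInterval u v), 0 < u → v < 1 →
      IsCompactlySupported (thompsonExtend h thompsonGenerator) := fun {u v} h hu hv =>
    ⟨u, v, hu, h.lt.le, hv, fun x hx => thompsonExtend_of_notMem h _ hx⟩
  obtain ⟨q, hq0, hq1⟩ := exists_between (show (0 : I) < 1 from zero_lt_one)
  obtain ⟨u, v, h, hu0, -, -, hv1⟩ := exists_isDyadicInterval hq0 hq1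
  obtain ⟨p, hup, hpv⟩ := exists_between h.lt
  set f := thompsonExtend h thompsonGenerator with hf
  obtain ⟨u', v', h', hu', hup', hpv', hv'⟩ :=
    exists_isDyadicInterval hup (lt_min hpv (lt_thompsonExtend_generator h hup hpv))
  rw [lt_min_iff, ← hf] at hv'
  refine ⟨f, _, key h hu0 hv1, key h' (hu0.trans hu') (hv'.1.trans hv1), fun hcomm => ?_⟩
  set g := thompsonExtend h' thompsonGenerator
  rw [mul_inv_eq_one, mul_inv_eq_iff_eq_mul] at hcomm
  have h1 : (f : HomeoPlus) ((g : HomeoPlus) p) = (g : HomeoPlus) ((f : HomeoPlus) p) :=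
    congrArg (fun k : ThompsonF => (k : HomeoPlus) p) hcomm
  rw [thompsonExtend_of_notMem h' _ fun hx => hx.2.not_gt hv'.2] at h1
  exact (lt_thompsonExtend_generator h' hup' hpv').ne' ((f : HomeoPlus).injective h1)

/-! ### Faithful invariant intervals of a `C^1` action, and the lower bound on their length. -/

/-- `[u, v]` is invariant under the action `φ`, which is faithful on it. -/
structure IsFaithfulInterval (φ : ThompsonF →* DiffPlusOne) (u v : I) : Prop where
  lt : u < v
  left : ∀ f, (φ f : HomeoPlus) u = u
  right : ∀ f, (φ f : HomeoPlus) v = v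
  faithful : ∀ f, (∀ y ∈ Icc u v, (φ f : HomeoPlus) y = y) → f = 1

theorem HomeoPlus.mapsTo_Icc {f : HomeoPlus} {u v : I} (hu : f u = u) (hv : f v = v) {y : I}
    (hy : y ∈ Icc u v) : f y ∈ Icc u v :=
  ⟨hu.symm.le.trans (f.monotone hy.1), (f.monotone hy.2).trans hv.le⟩

section

variable {φ : ThompsonF →* DiffPlusOne} {u v : I}

theorem coe_map_mul_apply (φ : ThompsonF →* DiffPlusOne) (f g : ThompsonF) (x : I) :
    (φ (f * g) : HomeoPlus) x = (φ f : HomeoPlus) ((φ g : HomeoPlus) x) := by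
  rw [map_mul]; rfl

theorem coe_map_inv_apply (φ : ThompsonF →* DiffPlusOne) (f : ThompsonF) (x : I) :
    (φ f⁻¹ : HomeoPlus) x = (φ f : HomeoPlus).symm x := by
  rw [map_inv]; rfl

theorem coe_map_one_apply (φ : ThompsonF →* DiffPlusOne) (x : I) :
    (φ 1 : HomeoPlus) x = x := by
  rw [_root_.map_one]; rfl

/-- The elements acting trivially on an invariant interval. -/
def intervalKernel (φ : ThompsonF →* DiffPlusOne) (u v : I) : Subgroup ThompsonF where
  carrier := {f | ∀ y ∈ Icc u v, (φ f : HomeoPlus) y = y}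
  one_mem' := fun y _ => coe_map_one_apply φ y
  mul_mem' := fun {f g} hf hg y hy => by rw [coe_map_mul_apply, hg y hy, hf y hy]
  inv_mem' := fun {f} hf y hy => by
    rw [coe_map_inv_apply, OrderIso.symm_apply_eq, hf y hy]

/-- The kernel of the action on `[u, v]` is normal. Were it nontrivial, it would contain every
commutator of compactly supported elements, whereas one of them moves `y`. -/
theorem isFaithfulInterval_of_commutator (huv : u < v) (hu : ∀ f, (φ f : HomeoPlus) u = u)
    (hv : ∀ f, (φ f : HomeoPlus) v = v) {f g : ThompsonF} (hf : IsCompactlySupported f)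
    (hg : IsCompactlySupported g) {y : I} (hy : y ∈ Icc u v)
    (hne : (φ (f * g * f⁻¹ * g⁻¹) : HomeoPlus) y ≠ y) : IsFaithfulInterval φ u v := by
  have hN : (intervalKernel φ u v).Normal := ⟨fun n hn k y hy => by
    rw [coe_map_mul_apply, coe_map_mul_apply, hn _ (HomeoPlus.mapsTo_Icc (hu _) (hv _) hy),
      ← coe_map_mul_apply, mul_inv_cancel, coe_map_one_apply]⟩
  have hbot : intervalKernel φ u v = ⊥ := by
    by_contra hbot
    exact hne (ThompsonF.commutator_mem_of_normal hN hbot hf hg y hy)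
  exact ⟨huv, hu, hv, fun f hf => (Subgroup.eq_bot_iff_forall _).1 hbot f hf⟩

theorem IsC1.restrict {f : I → I} (hf : IsC1 f) (huv : u < v)
    (hm : ∀ y ∈ Icc u v, f y ∈ Icc u v) :
    IsC1 (fun y => affineProj u v (f (affineIcc u v y))) := by
  have hp := coe_sub_pos huv
  have ha : ContDiffOn ℝ 1 (fun x : ℝ => (u : ℝ) + (v - u) * x) (Icc 0 1) := by fun_prop
  have h := ContDiffOn.comp (s := Icc (0 : ℝ) 1) hf ha
    (fun x hx => (affineIcc u v ⟨x, hx⟩).2)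
  refine ((h.sub (contDiffOn_const (c := (u : ℝ)))).div_const ((v : ℝ) - u)).congr fun x hx => ?_
  have h1 := congrArg Subtype.val
    (affineIcc_affineProj huv (hm _ (affineIcc_mem huv ⟨x, hx⟩)))
  rw [IccExtend_of_mem _ _ hx, Function.comp_apply,
    IccExtend_of_mem (x := (u : ℝ) + (v - u) * x) _ _ (affineIcc u v ⟨x, hx⟩).2, eq_div_iff hp.ne']
  rw [coe_affineIcc] at h1
  change (affineProj u v (f (affineIcc u v ⟨x, hx⟩)) : ℝ) * (v - u) =
    f (affineIcc u v ⟨x, hx⟩) - u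
  linear_combination h1

theorem IsFaithfulInterval.affineIcc_affineProj_apply (h : IsFaithfulInterval φ u v)
    (f : ThompsonF) {x : I} (hx : x ∈ Icc u v) :
    affineIcc u v (affineProj u v ((φ f : HomeoPlus) x)) = (φ f : HomeoPlus) x :=
  affineIcc_affineProj h.lt (HomeoPlus.mapsTo_Icc (h.left f) (h.right f) hx)

/-- The action on an invariant interval, as an action on `I`. -/
noncomputable def IsFaithfulInterval.restrictHomeo (h : IsFaithfulInterval φ u v) (f : ThompsonF) :
    HomeoPlus := Equiv.toOrderIso
  { toFun := fun y => affineProj u v ((φ f : HomeoPlus) (affineIcc u v y))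
    invFun := fun y => affineProj u v ((φ f⁻¹ : HomeoPlus) (affineIcc u v y))
    left_inv := fun y => by
      dsimp only
      rw [h.affineIcc_affineProj_apply f (affineIcc_mem h.lt y), ← coe_map_mul_apply,
        inv_mul_cancel, coe_map_one_apply, affineProj_affineIcc h.lt]
    right_inv := fun y => by
      dsimp only
      rw [h.affineIcc_affineProj_apply f⁻¹ (affineIcc_mem h.lt y), ← coe_map_mul_apply,
        mul_inv_cancel, coe_map_one_apply, affineProj_affineIcc h.lt] }
  ((monotone_affineProj h.lt).comp ((OrderIso.monotone _).comp (strictMono_affineIcc h.lt).monotone))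
  ((monotone_affineProj h.lt).comp ((OrderIso.monotone _).comp (strictMono_affineIcc h.lt).monotone))

/-- The `C^1` action on `I` obtained from the action on an invariant interval. -/
noncomputable def IsFaithfulInterval.restrictHom (h : IsFaithfulInterval φ u v) :
    ThompsonF →* DiffPlusOne where
  toFun f := ⟨h.restrictHomeo f,
    (φ f).2.1.restrict h.lt fun _ hy => HomeoPlus.mapsTo_Icc (h.left f) (h.right f) hy,
    (φ f⁻¹).2.1.restrict h.lt fun _ hy => HomeoPlus.mapsTo_Icc (h.left f⁻¹) (h.right f⁻¹) hy⟩
  map_one' := Subtype.ext <| RelIso.ext fun y => by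
    change affineProj u v ((φ 1 : HomeoPlus) (affineIcc u v y)) = y
    rw [coe_map_one_apply, affineProj_affineIcc h.lt]
  map_mul' f g := Subtype.ext <| RelIso.ext fun y => by
    change affineProj u v ((φ (f * g) : HomeoPlus) (affineIcc u v y)) =
      affineProj u v ((φ f : HomeoPlus) (affineIcc u v
        (affineProj u v ((φ g : HomeoPlus) (affineIcc u v y)))))
    rw [h.affineIcc_affineProj_apply g (affineIcc_mem h.lt y), coe_map_mul_apply]

theorem IsFaithfulInterval.restrictHom_injective (h : IsFaithfulInterval φ u v) :
    Injective h.restrictHom := by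
  rw [injective_iff_map_eq_one]
  refine fun f hf => h.faithful f fun y hy => ?_
  have h1 : affineProj u v ((φ f : HomeoPlus) (affineIcc u v (affineProj u v y))) =
      affineProj u v y :=
    congrArg (fun k : DiffPlusOne => (k : HomeoPlus) (affineProj u v y)) hf
  have h2 := congrArg (affineIcc u v) h1
  rwa [affineIcc_affineProj h.lt hy, h.affineIcc_affineProj_apply f hy] at h2

/-- `H` semiconjugates the action `φ` on `[u, v]` to the standard action of Thompson's group. -/
structure IsIntervalSemiconj (φ : ThompsonF →* DiffPlusOne) (u v : I) (H : I → I) : Prop where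
  monotone : Monotone H ∨ Antitone H
  continuous : Continuous H
  exists_eq : ∀ c, ∃ z ∈ Icc u v, H z = c
  map_apply : ∀ (f : ThompsonF), ∀ z ∈ Icc u v, H ((φ f : HomeoPlus) z) = (f : HomeoPlus) (H z)

theorem IsFaithfulInterval.exists_semiconj
    (hsemi : ∀ φ : ThompsonF →* DiffPlusOne, Injective φ →
      IsSemiconjugateTo (DiffPlusOne.subtype.comp φ) ThompsonF.subtype)
    (h : IsFaithfulInterval φ u v) : ∃ H, IsIntervalSemiconj φ u v H := by
  obtain ⟨k, hk, hsurj, hcont, heq⟩ := hsemi h.restrictHom h.restrictHom_injective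
  refine ⟨fun z => k (affineProj u v z), ?_, hcont.comp (continuous_affineProj u v), ?_, ?_⟩
  · exact hk.imp (fun hk => hk.comp (monotone_affineProj h.lt))
      (fun hk => hk.comp_monotone (monotone_affineProj h.lt))
  · intro c
    obtain ⟨y, rfl⟩ := hsurj c
    exact ⟨affineIcc u v y, affineIcc_mem h.lt y, by rw [affineProj_affineIcc h.lt]⟩
  · intro f z hz
    have h1 : k (affineProj u v ((φ f : HomeoPlus) (affineIcc u v (affineProj u v z)))) =
      (f : HomeoPlus) (k (affineProj u v z)) := heq f (affineProj u v z)
    rwa [affineIcc_affineProj h.lt hz] at h1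

/-- By the mean value theorem the derivative is `1` somewhere between the fixed points `u` and `v`.
By uniform continuity it exceeds `1/2` throughout a short `[u, v]`, so no subinterval is contracted
to half its length. -/
theorem IsC1.exists_forall_half_lt {f : I → I} (hf : IsC1 f) : ∃ δ : ℝ, 0 < δ ∧
    ∀ u v p q : I, f u = u → f v = v → u ≤ p → p < q → q ≤ v → (v : ℝ) - u < δ →
      ((q : ℝ) - p) / 2 < f q - f p := by
  set G : ℝ → ℝ := IccExtend (zero_le_one' ℝ) (fun x => (f x : ℝ)) with hG
  have hGf : ∀ x : I, G x = f x := fun x => by rw [hG, IccExtend_of_mem _ _ x.2]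
  have hd : ContinuousOn (derivWithin G (Icc 0 1)) (Icc 0 1) :=
    hf.continuousOn_derivWithin (uniqueDiffOn_Icc zero_lt_one) le_rfl
  obtain ⟨δ, hδ, hunif⟩ := Metric.uniformContinuousOn_iff.1
    (isCompact_Icc.uniformContinuousOn_of_continuous hd) (1 / 2) (by norm_num)
  have hmvt : ∀ a b : I, a < b → ∃ c ∈ Ioo (a : ℝ) b,
      derivWithin G (Icc 0 1) c = ((f b : ℝ) - f a) / (b - a) := by
    intro a b hab
    have hab' : (a : ℝ) < b := hab
    have hsub : Icc (a : ℝ) b ⊆ Icc 0 1 := Icc_subset_Icc a.2.1 b.2.2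
    rw [← hGf, ← hGf]
    refine exists_hasDerivAt_eq_slope G _ hab' (hf.continuousOn.mono hsub) fun x hx => ?_
    have hx' : Icc (0 : ℝ) 1 ∈ nhds x :=
      Icc_mem_nhds (a.2.1.trans_lt hx.1) (hx.2.trans_le b.2.2)
    exact ((hf.differentiableOn one_ne_zero x (mem_of_mem_nhds hx')).hasDerivWithinAt).hasDerivAt hx'
  refine ⟨δ, hδ, fun u v p q hu hv hup hpq hqv hlt => ?_⟩
  obtain ⟨c, hc, hc'⟩ := hmvt u v (hup.trans_lt (hpq.trans_le hqv))
  obtain ⟨d, hd, hd'⟩ := hmvt p q hpq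
  have hup' : (u : ℝ) ≤ p := hup
  have hpq' : (p : ℝ) < q := hpq
  have hqv' : (q : ℝ) ≤ v := hqv
  have hu0 := u.2.1
  have hv1 := v.2.2
  have hcd : dist c d < δ := by
    rw [Real.dist_eq, abs_lt]
    constructor <;> linarith [hc.1, hc.2, hd.1, hd.2]
  have h1 := hunif c ⟨by linarith [hc.1], by linarith [hc.2]⟩ d
    ⟨by linarith [hd.1], by linarith [hd.2]⟩ hcd
  rw [hc', hd', hu, hv, div_self (by linarith), Real.dist_eq, abs_lt] at h1
  have h2 : 1 / 2 < ((f q : ℝ) - f p) / (q - p) := by linarith [h1.2]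
  rw [lt_div_iff₀ (by linarith)] at h2
  linarith

/-- On a short faithful interval, two elements would send some `[p, q]` to disjoint subintervals of
`[p, q]`, each longer than half of it. The elements are fixed in advance in `F`, so the bound does
not depend on the interval. -/
theorem exists_le_length_of_isFaithfulInterval
    (hsemi : ∀ φ : ThompsonF →* DiffPlusOne, Injective φ →
      IsSemiconjugateTo (DiffPlusOne.subtype.comp φ) ThompsonF.subtype)
    (φ : ThompsonF →* DiffPlusOne) :
    ∃ δ : ℝ, 0 < δ ∧ ∀ u v, IsFaithfulInterval φ u v → δ ≤ (v : ℝ) - u := by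
  obtain ⟨m, hm0, hm1⟩ := exists_between (show (0 : I) < 1 from zero_lt_one)
  obtain ⟨a, ha0, ham⟩ := exists_between hm0
  obtain ⟨b, hmb, hb1⟩ := exists_between hm1
  -- `f` sends `[a, b]` into `(a, m)` and `g` sends it into `(m, b)`; the semiconjugacy lifts this
  -- configuration to `[u, v]`.
  obtain ⟨f, hf1, hf2⟩ := exists_thompson_compress ha0 (ham.trans hmb).le hb1 ham
  obtain ⟨g, hg1, hg2⟩ := exists_thompson_compress ha0 (ham.trans hmb).le hb1 hmb
  obtain ⟨δ₁, hδ₁, h₁⟩ := (φ f).2.1.exists_forall_half_lt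
  obtain ⟨δ₂, hδ₂, h₂⟩ := (φ g).2.1.exists_forall_half_lt
  refine ⟨min δ₁ δ₂, lt_min hδ₁ hδ₂, fun u v h => not_lt.1 fun hlt => ?_⟩
  rw [lt_min_iff] at hlt
  obtain ⟨H, hH⟩ := h.exists_semiconj hsemi
  obtain ⟨p, hp, hpa⟩ := hH.exists_eq a
  obtain ⟨q, hq, hqb⟩ := hH.exists_eq b
  have hfg : (f : HomeoPlus) b < (g : HomeoPlus) a := hf2.trans hg1
  rw [← hpa, ← hqb, ← hH.map_apply f q hq, ← hH.map_apply g p hp] at hfg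
  rw [← hpa, ← hH.map_apply f p hp] at hf1
  rw [← hqb, ← hH.map_apply g q hq] at hg2
  have hpq : H p < H q := by rw [hpa, hqb]; exact ham.trans hmb
  rcases hH.monotone with hmono | hanti
  · have e1 : (p : ℝ) < (φ f : HomeoPlus) p := hmono.reflect_lt hf1
    have e2 : (((φ f : HomeoPlus) q : I) : ℝ) < (φ g : HomeoPlus) p := hmono.reflect_lt hfg
    have e3 : (((φ g : HomeoPlus) q : I) : ℝ) < q := hmono.reflect_lt hg2
    have e4 := hmono.reflect_lt hpq
    have k1 := h₁ u v p q (h.left f) (h.right f) hp.1 e4 hq.2 hlt.1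
    have k2 := h₂ u v p q (h.left g) (h.right g) hp.1 e4 hq.2 hlt.2
    linarith
  · have e1 : (((φ f : HomeoPlus) p : I) : ℝ) < p := hanti.reflect_lt hf1
    have e2 : (((φ g : HomeoPlus) p : I) : ℝ) < (φ f : HomeoPlus) q := hanti.reflect_lt hfg
    have e3 : (q : ℝ) < (φ g : HomeoPlus) q := hanti.reflect_lt hg2
    have e4 := hanti.reflect_lt hpq
    have k1 := h₁ u v q p (h.left f) (h.right f) hq.1 e4 hp.2 hlt.1
    have k2 := h₂ u v q p (h.left g) (h.right g) hq.1 e4 hp.2 hlt.2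
    linarith

end

/-! ### Faithful components and the supports of commutators. -/

section

variable {φ : ThompsonF →* DiffPlusOne} {u v : I}

/-- A faithful invariant interval without global fixed points in its interior. -/
structure IsFaithfulComponent (φ : ThompsonF →* DiffPlusOne) (u v : I) : Prop
    extends IsFaithfulInterval φ u v where
  notMem_Ioo : ∀ x, (∀ f, (φ f : HomeoPlus) x = x) → x ∉ Ioo u v

theorem isClosed_globalFixedPoints (φ : ThompsonF →* DiffPlusOne) :
    IsClosed {x | ∀ f, (φ f : HomeoPlus) x = x} := by
  simp only [ofPred_forall]
  exact isClosed_iInter fun f => isClosed_eq (OrderIso.continuous _) continuous_id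

/-- The endpoints are the last global fixed point before `y` and the first one after it. -/
theorem exists_isFaithfulComponent {f g : ThompsonF} (hf : IsCompactlySupported f)
    (hg : IsCompactlySupported g) {y : I} (hne : (φ (f * g * f⁻¹ * g⁻¹) : HomeoPlus) y ≠ y) :
    ∃ u v, IsFaithfulComponent φ u v ∧ y ∈ Icc u v := by
  set X : Set I := {x | ∀ f, (φ f : HomeoPlus) x = x} with hX
  have hXc : IsClosed X := isClosed_globalFixedPoints φ
  have hyX : y ∉ X := fun h => hne (h _)
  have hl := (hXc.inter isClosed_Iic).isCompact.isGreatest_sSup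
    (s := X ∩ Iic y) ⟨0, fun f => HomeoPlus.map_zero _, show (0 : I) ≤ y from bot_le⟩
  have hr := (hXc.inter isClosed_Ici).isCompact.isLeast_sInf
    (s := X ∩ Ici y) ⟨1, fun f => HomeoPlus.map_one _, show y ≤ (1 : I) from le_top⟩
  set u := sSup (X ∩ Iic y)
  set v := sInf (X ∩ Ici y)
  have hy : y ∈ Icc u v := ⟨hl.1.2, hr.1.2⟩
  have huy : u ≠ y := fun h => hyX (h ▸ hl.1.1)
  refine ⟨u, v, ⟨isFaithfulInterval_of_commutator ((lt_of_le_of_ne hy.1 huy).trans_le hy.2)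
    hl.1.1 hr.1.1 hf hg hy hne, fun x hx hxm => ?_⟩, hy⟩
  rcases le_total x y with h | h
  · exact absurd (hl.2 ⟨hx, h⟩) (not_le.2 hxm.1)
  · exact absurd (hr.2 ⟨hx, h⟩) (not_le.2 hxm.2)

/-- A fibre of a continuous monotone map is a closed interval. The stabiliser of `q` preserves the
fibre over `q` and the orientation, hence fixes both endpoints. -/
theorem IsIntervalSemiconj.exists_fiber_eq_Icc {H : I → I} (hH : IsIntervalSemiconj φ u v H)
    (hu : ∀ f, (φ f : HomeoPlus) u = u) (hv : ∀ f, (φ f : HomeoPlus) v = v) (q : I) :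
    ∃ a b, (∀ z, z ∈ Icc a b ↔ z ∈ Icc u v ∧ H z = q) ∧ a ≤ b ∧
      ∀ f : ThompsonF, (f : HomeoPlus) q = q →
        (φ f : HomeoPlus) a = a ∧ (φ f : HomeoPlus) b = b := by
  set E : Set I := Icc u v ∩ H ⁻¹' {q} with hE
  have hEc : IsCompact E := (isClosed_Icc.inter (isClosed_singleton.preimage hH.continuous)).isCompact
  have hEn : E.Nonempty := by
    obtain ⟨z, hz, rfl⟩ := hH.exists_eq q
    exact ⟨z, hz, rfl⟩
  have hEo : E.OrdConnected := by
    refine ordConnected_Icc.inter ?_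
    rcases hH.monotone with h | h
    · exact ordConnected_singleton.preimage_mono h
    · exact ordConnected_singleton.preimage_anti h
  have hl := hEc.isLeast_sInf hEn
  have hr := hEc.isGreatest_sSup hEn
  have hmaps : ∀ f : ThompsonF, (f : HomeoPlus) q = q → ∀ z ∈ E, (φ f : HomeoPlus) z ∈ E :=
    fun f hf z hz => ⟨HomeoPlus.mapsTo_Icc (hu f) (hv f) hz.1, by
      change H _ = q
      rw [hH.map_apply f z hz.1, show H z = q from hz.2, hf]⟩
  refine ⟨sInf E, sSup E, fun z => ⟨fun hz => hEo.out hl.1 hr.1 hz,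
    fun hz => ⟨hl.2 hz, hr.2 hz⟩⟩, hl.2 hr.1, fun f hf => ?_⟩
  have hf' : ((f⁻¹ : ThompsonF) : HomeoPlus) q = q :=
    (OrderIso.symm_apply_eq (f : HomeoPlus)).2 hf.symm
  constructor
  · refine le_antisymm ?_ (hl.2 (hmaps f hf _ hl.1))
    have := hl.2 (hmaps f⁻¹ hf' _ hl.1)
    rwa [coe_map_inv_apply, OrderIso.le_symm_apply] at this
  · refine le_antisymm (hr.2 (hmaps f hf _ hr.1)) ?_
    have := hr.2 (hmaps f⁻¹ hf' _ hr.1)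
    rwa [coe_map_inv_apply, OrderIso.symm_apply_le] at this

/-- A copy of the generator on a small dyadic interval around `q`, disjoint from `(α, β)`. -/
theorem exists_commute_thompsonExtend {α β q : I} (h : IsDyadicInterval α β) (hq0 : 0 < q)
    (hq1 : q < 1) (hq : q ∉ Icc α β) : ∃ g : ThompsonF, q < (g : HomeoPlus) q ∧
      ∀ f, Commute g (thompsonExtend h f) := by
  obtain ⟨a, b, haq, hqb, hdis⟩ : ∃ a b : I, a < q ∧ q < b ∧ ∀ x ∈ Ioo a b, x ∉ Ioo α β := by
    rcases lt_or_ge q α with h1 | h1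
    · exact ⟨0, α, hq0, h1, fun x hx hx' => hx.2.not_gt hx'.1⟩
    · exact ⟨β, 1, not_le.1 fun h2 => hq ⟨h1, h2⟩, hq1, fun x hx hx' => hx.1.not_gt hx'.2⟩
  obtain ⟨w, w', hw, haw, hwq, hqw', hw'b⟩ := exists_isDyadicInterval haq hqb
  refine ⟨thompsonExtend hw thompsonGenerator, lt_thompsonExtend_generator hw hwq hqw',
    fun f => ThompsonF.commute_of_disjoint fun x => ?_⟩
  by_cases hx : x ∈ Ioo w w'
  · exact Or.inr (thompsonExtend_of_notMem h f (hdis x ⟨haw.trans hx.1, hx.2.trans hw'b⟩))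
  · exact Or.inl (thompsonExtend_of_notMem hw _ hx)

theorem IsFaithfulInterval.translate {j : ThompsonF →* ThompsonF} {a b : I}
    (h : IsFaithfulInterval (φ.comp j) a b) {k : ThompsonF} (hk : ∀ f, Commute k (j f)) :
    IsFaithfulInterval (φ.comp j) ((φ k : HomeoPlus) a) ((φ k : HomeoPlus) b) := by
  have key : ∀ f x, (φ (j f) : HomeoPlus) ((φ k : HomeoPlus) x) =
      (φ k : HomeoPlus) ((φ (j f) : HomeoPlus) x) := fun f x => by
    rw [← coe_map_mul_apply, ← coe_map_mul_apply, (hk f).eq]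
  refine ⟨(OrderIso.strictMono _) h.lt, fun f => ?_, fun f => ?_, fun f hf => ?_⟩
  · exact (key f a).trans (congrArg _ (h.left f))
  · exact (key f b).trans (congrArg _ (h.right f))
  · refine h.faithful f fun y hy => (φ k : HomeoPlus).injective ?_
    exact (key f y).symm.trans
      (hf _ ⟨(OrderIso.monotone _) hy.1, (OrderIso.monotone _) hy.2⟩)

/-- Write `F_K` for the copy of `F` on `K = [α, β]`. If `H y` were outside `K`, then `F_K` would fix
it, hence preserve its fibre `[a, b]`, and act faithfully there because a commutator moves `y`. An
element `k` commuting with `F_K` and moving `H y` carries the fibre to disjoint fibres, and every `φ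
(k ^ n)` image is again faithful for `F_K`. This gives infinitely many disjoint intervals of length
at least `δ` in `I`. -/
theorem IsFaithfulComponent.map_mem_Icc
    (hsemi : ∀ φ : ThompsonF →* DiffPlusOne, Injective φ →
      IsSemiconjugateTo (DiffPlusOne.subtype.comp φ) ThompsonF.subtype)
    (h : IsFaithfulComponent φ u v) {H : I → I} (hH : IsIntervalSemiconj φ u v H)
    {f g : ThompsonF} (hf : IsCompactlySupported f) (hg : IsCompactlySupported g) {α β : I}
    (hK : IsDyadicInterval α β) {y : I} (hy : y ∈ Icc u v)
    (hne : (φ (thompsonExtend hK (f * g * f⁻¹ * g⁻¹)) : HomeoPlus) y ≠ y) : H y ∈ Icc α β := by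
  by_contra hq
  obtain ⟨a, b, hE, -, hfix⟩ := hH.exists_fiber_eq_Icc h.left h.right (H y)
  have hyE : y ∈ Icc a b := (hE y).2 ⟨hy, rfl⟩
  have hKq : ∀ k, (thompsonExtend hK k : HomeoPlus) (H y) = H y := fun k =>
    thompsonExtend_of_notMem hK k fun hm => hq ⟨hm.1.le, hm.2.le⟩
  have hay : a < y := lt_of_le_of_ne hyE.1 fun h => hne (h ▸ (hfix _ (hKq _)).1)
  have hyb : y < b := lt_of_le_of_ne hyE.2 fun h => hne (h ▸ (hfix _ (hKq _)).2)
  have haE := (hE a).1 ⟨le_rfl, (hay.trans hyb).le⟩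
  have hbE := (hE b).1 ⟨(hay.trans hyb).le, le_rfl⟩
  -- If all of `F` fixes `H y`, then `a` and `b` are global fixed points, so the fibre is the whole
  -- component and `H` is constant on it, contradicting its surjectivity.
  by_cases hglob : ∀ k : ThompsonF, (k : HomeoPlus) (H y) = H y
  · have ha : a = u := by
      by_contra hne
      exact h.notMem_Ioo a (fun k => (hfix k (hglob k)).1)
        ⟨lt_of_le_of_ne haE.1.1 (Ne.symm hne), hay.trans_le hy.2⟩
    have hb : b = v := by
      by_contra hne
      exact h.notMem_Ioo b (fun k => (hfix k (hglob k)).2)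
        ⟨hy.1.trans_lt hyb, lt_of_le_of_ne hbE.1.2 hne⟩
    subst ha hb
    obtain ⟨z, hz, hz0⟩ := hH.exists_eq 0
    obtain ⟨w, hw, hw1⟩ := hH.exists_eq 1
    refine zero_ne_one (α := I) ?_
    rw [← hz0, ← hw1, ((hE z).1 hz).2, ((hE w).1 hw).2]
  · have hq0 : 0 < H y := bot_lt_iff_ne_bot.2 fun h0 => hglob fun k => by
      rw [show H y = 0 from h0, HomeoPlus.map_zero]
    have hq1 : H y < 1 := lt_top_iff_ne_top.2 fun h1 => hglob fun k => by
      rw [show H y = 1 from h1, HomeoPlus.map_one]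
    obtain ⟨k₀, hk₀, hcomm₀⟩ := exists_commute_thompsonExtend hK hq0 hq1 hq
    have hFI : IsFaithfulInterval (φ.comp (thompsonExtend hK)) a b :=
      isFaithfulInterval_of_commutator (hay.trans hyb) (fun k => (hfix _ (hKq k)).1)
        (fun k => (hfix _ (hKq k)).2) hf hg hyE hne
    obtain ⟨δ, hδ, hlen⟩ :=
      exists_le_length_of_isFaithfulInterval hsemi (φ.comp (thompsonExtend hK))
    have hout : ∀ k : ThompsonF, (k : HomeoPlus) (H y) ≠ H y → (φ k : HomeoPlus) a ∉ Icc a b := by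
      intro k hk hmem
      have := ((hE _).1 hmem).2
      rw [hH.map_apply k a haE.1, haE.2] at this
      exact hk this
    -- `H` may reverse orientation, so `k₀` may move the fibre to the left; its inverse then moves
    -- it to the right.
    obtain ⟨k, hcomm, hkb⟩ : ∃ k : ThompsonF, (∀ f, Commute k (thompsonExtend hK f)) ∧
        b < (φ k : HomeoPlus) a := by
      rcases lt_or_ge ((φ k₀ : HomeoPlus) a) a with h1 | h1
      · have h2 : a < (φ k₀⁻¹ : HomeoPlus) a := by
          rwa [coe_map_inv_apply, OrderIso.lt_symm_apply]
        refine ⟨k₀⁻¹, fun f => (hcomm₀ f).inv_left, not_le.1 fun h3 => ?_⟩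
        refine hout k₀⁻¹ (fun h4 => hk₀.ne ?_) ⟨h2.le, h3⟩
        exact (OrderIso.symm_apply_eq (k₀ : HomeoPlus)).1 h4
      · exact ⟨k₀, hcomm₀, not_le.1 fun h3 => hout k₀ hk₀.ne' ⟨h1, h3⟩⟩
    have hgrow : ∀ n : ℕ, n * δ ≤ ((φ (k ^ n) : HomeoPlus) a : ℝ) := by
      intro n
      induction n with
      | zero => rw [Nat.cast_zero, zero_mul]; exact ((φ (k ^ 0) : HomeoPlus) a).2.1
      | succ n ih =>
        have h1 := hlen _ _ (hFI.translate (k := k ^ n) fun f => (hcomm f).pow_left n)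
        have h2 : (φ (k ^ n) : HomeoPlus) b < (φ (k ^ (n + 1)) : HomeoPlus) a := by
          rw [pow_succ, coe_map_mul_apply]
          exact (OrderIso.strictMono _) hkb
        have h2 : (((φ (k ^ n) : HomeoPlus) b : I) : ℝ) < (φ (k ^ (n + 1)) : HomeoPlus) a := h2
        push_cast
        linarith
    obtain ⟨n, hn⟩ := exists_nat_gt (1 / δ)
    rw [div_lt_iff₀ hδ] at hn
    exact absurd ((hgrow n).trans ((φ (k ^ n) : HomeoPlus) a).2.2) (not_le.2 hn)

/-- Distinct components have disjoint interiors and length at least `δ`. Their left endpoints are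
therefore `δ` apart, and the integer part of the left endpoint divided by `δ` distinguishes them. -/
theorem finite_isFaithfulComponent
    (hsemi : ∀ φ : ThompsonF →* DiffPlusOne, Injective φ →
      IsSemiconjugateTo (DiffPlusOne.subtype.comp φ) ThompsonF.subtype)
    (φ : ThompsonF →* DiffPlusOne) : {p : I × I | IsFaithfulComponent φ p.1 p.2}.Finite := by
  obtain ⟨δ, hδ, hlen⟩ := exists_le_length_of_isFaithfulInterval hsemi φ
  have hsep : ∀ p q : I × I, IsFaithfulComponent φ p.1 p.2 → IsFaithfulComponent φ q.1 q.2 →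
      p.1 < q.1 → (p.1 : ℝ) / δ + 1 ≤ q.1 / δ := by
    intro p q hp hq hpq
    have h1 : (p.2 : ℝ) ≤ q.1 := not_lt.1 fun h => hp.notMem_Ioo q.1 hq.left ⟨hpq, h⟩
    rw [← div_self hδ.ne', ← add_div]
    exact div_le_div_of_nonneg_right (by linarith [hlen _ _ hp.toIsFaithfulInterval]) hδ.le
  have hfloor : ∀ p q : I × I, IsFaithfulComponent φ p.1 p.2 → IsFaithfulComponent φ q.1 q.2 →
      p.1 < q.1 → ⌊(p.1 : ℝ) / δ⌋₊ < ⌊(q.1 : ℝ) / δ⌋₊ := by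
    intro p q hp hq hpq
    rw [Nat.lt_iff_add_one_le, ← Nat.floor_add_one (div_nonneg p.1.2.1 hδ.le)]
    exact Nat.floor_mono (hsep p q hp hq hpq)
  refine Set.Finite.of_injOn (f := fun p : I × I => ⌊(p.1 : ℝ) / δ⌋₊) (t := Iic ⌊1 / δ⌋₊)
    (fun p _ => Nat.floor_mono (div_le_div_of_nonneg_right p.1.2.2 hδ.le)) ?_ (finite_Iic _)
  intro p hp q hq hpq
  have h1 : p.1 = q.1 := by
    rcases lt_trichotomy p.1 q.1 with h | h | h
    · exact absurd hpq (hfloor p q hp hq h).ne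
    · exact h
    · exact absurd hpq (hfloor q p hq hp h).ne'
  refine Prod.ext h1 ?_
  rcases lt_trichotomy p.2 q.2 with h | h | h
  · exact absurd ⟨h1 ▸ hp.lt, h⟩ (hq.notMem_Ioo p.2 hp.right)
  · exact h
  · exact absurd ⟨h1 ▸ hq.lt, h⟩ (hp.notMem_Ioo q.2 hq.right)

/-- The index set is the set of faithful components. A point moved by the commutator lies in one of
them, because the copies of `f` and `g` on `[α, β]` are still compactly supported. The maps `H i` do
not depend on `[α, β]`. -/
theorem exists_finite_family_semiconj
    (hsemi : ∀ φ : ThompsonF →* DiffPlusOne, Injective φ →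
      IsSemiconjugateTo (DiffPlusOne.subtype.comp φ) ThompsonF.subtype)
    (φ : ThompsonF →* DiffPlusOne) {f g : ThompsonF} (hf : IsCompactlySupported f)
    (hg : IsCompactlySupported g) :
    ∃ (ι : Type) (_ : Finite ι) (H : ι → I → I),
      (∀ i, Continuous (H i) ∧ (Monotone (H i) ∨ Antitone (H i))) ∧
      ∀ {α β : I} (hK : IsDyadicInterval α β) (y : I),
        (φ (thompsonExtend hK (f * g * f⁻¹ * g⁻¹)) : HomeoPlus) y ≠ y → ∃ i, H i y ∈ Icc α β := by
  have hex : ∀ p : {p : I × I | IsFaithfulComponent φ p.1 p.2},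
      ∃ H, IsIntervalSemiconj φ p.1.1 p.1.2 H := fun p =>
    p.2.toIsFaithfulInterval.exists_semiconj hsemi
  choose H hH using hex
  refine ⟨_, finite_isFaithfulComponent hsemi φ, H,
    fun p => ⟨(hH p).continuous, (hH p).monotone⟩, fun {α β} hK y hne => ?_⟩
  have hcomm : thompsonExtend hK (f * g * f⁻¹ * g⁻¹) = thompsonExtend hK f * thompsonExtend hK g *
      (thompsonExtend hK f)⁻¹ * (thompsonExtend hK g)⁻¹ := by simp only [map_mul, map_inv]
  have hne' := hne
  rw [hcomm] at hne'
  obtain ⟨u, v, huv, hy⟩ :=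
    exists_isFaithfulComponent (hf.thompsonExtend hK) (hg.thompsonExtend hK) hne'
  exact ⟨⟨(u, v), huv⟩, huv.map_mem_Icc hsemi (hH ⟨(u, v), huv⟩) hf hg hK hy hne⟩

end

/-! ### Separating fibres, and commuting conjugates. -/

/-- Each nondegenerate fibre contains a point of a countable dense set. -/
theorem countable_setOf_fiber_nontrivial {H : I → I} (hH : Monotone H ∨ Antitone H) :
    {c | ∃ x y, x < y ∧ H x = c ∧ H y = c}.Countable := by
  obtain ⟨D, hDc, hDd⟩ := TopologicalSpace.exists_countable_dense I
  refine (hDc.image H).mono ?_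
  rintro c ⟨x, y, hxy, hx, hy⟩
  obtain ⟨d, hd, hxd, hdy⟩ := hDd.exists_between hxy
  refine ⟨d, hd, ?_⟩
  rcases hH with h | h
  · exact le_antisymm ((h hdy.le).trans hy.le) (hx.symm.le.trans (h hxd.le))
  · exact le_antisymm ((h hxd.le).trans hx.le) (hy.symm.le.trans (h hdy.le))

theorem exists_mem_Ioo_notMem_of_countable {B : Set I} (hB : B.Countable) :
    ∃ c : I, 0 < c ∧ c < 1 ∧ c ∉ B := by
  obtain ⟨c, hc, hcB⟩ := ((hB.image Subtype.val).dense_compl ℝ).inter_open_nonempty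
    (Ioo (0 : ℝ) 1) isOpen_Ioo ⟨1 / 2, by norm_num⟩
  exact ⟨⟨c, hc.1.le, hc.2.le⟩, hc.1, hc.2, fun h => hcB ⟨_, h, rfl⟩⟩

theorem exists_pos_forall_le_of_finite {ι : Type*} [Finite ι] {r : ι → ℝ} (hr : ∀ i, 0 < r i) :
    ∃ ε, 0 < ε ∧ ∀ i, ε ≤ r i := by
  cases isEmpty_or_nonempty ι
  · exact ⟨1, one_pos, fun i => isEmptyElim i⟩
  · obtain ⟨i, hi⟩ := Finite.exists_min r
    exact ⟨r i, hr i, hi⟩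

/-- Choose `c'` so that each `H j` has at most one point over it, then `c` outside the countable set
of values `H i (t x)` at those points. The fibres over `c` thus avoid the `t`-images of the fibres
over `c'`, and compactness makes the separation uniform. -/
theorem exists_separated_fibers {ι : Type*} [Finite ι] {H : ι → I → I}
    (hH : ∀ i, Continuous (H i) ∧ (Monotone (H i) ∨ Antitone (H i))) (t : HomeoPlus) :
    ∃ c c' : I, (0 < c ∧ c < 1) ∧ (0 < c' ∧ c' < 1) ∧ ∃ r : ℝ, 0 < r ∧
      ∀ i j y, dist (H i (t y)) c < r → r ≤ dist (H j y) c' := by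
  obtain ⟨c', hc'0, hc'1, hc'⟩ := exists_mem_Ioo_notMem_of_countable
    (countable_iUnion fun j => countable_setOf_fiber_nontrivial (hH j).2)
  have hsub : ∀ j, {x | H j x = c'}.Subsingleton := by
    intro j x hx y hy
    by_contra hne
    refine hc' (mem_iUnion.2 ⟨j, ?_⟩)
    rcases lt_or_gt_of_ne hne with h | h
    · exact ⟨x, y, h, hx, hy⟩
    · exact ⟨y, x, h, hy, hx⟩
  obtain ⟨c, hc0, hc1, hc⟩ := exists_mem_Ioo_notMem_of_countable
    (B := ⋃ p : ι × ι, (fun x => H p.1 (t x)) '' {x | H p.2 x = c'})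
    (countable_iUnion fun p => ((hsub p.2).finite.image _).countable)
  have hpos : ∀ p : ι × ι, ∃ r : ℝ, 0 < r ∧
      ∀ y, r ≤ max (dist (H p.1 (t y)) c) (dist (H p.2 y) c') := by
    intro p
    have hcont : Continuous fun y => max (dist (H p.1 (t y)) c) (dist (H p.2 y) c') :=
      (((hH p.1).1.comp t.continuous).dist continuous_const).max
        ((hH p.2).1.dist continuous_const)
    -- The minimum is positive: at a zero, `y` would lie over `c'` and `t y` over `c`.
    obtain ⟨y, -, hy⟩ := isCompact_univ.exists_isMinOn univ_nonempty hcont.continuousOn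
    refine ⟨_, ?_, fun z => hy (mem_univ z)⟩
    by_contra! hle
    have h1 := (le_max_left _ _).trans hle
    have h2 := (le_max_right _ _).trans hle
    rw [dist_le_zero] at h1 h2
    exact hc (mem_iUnion.2 ⟨p, y, h2, h1⟩)
  choose r hr hr' using hpos
  obtain ⟨ε, hε, hεr⟩ := exists_pos_forall_le_of_finite hr
  refine ⟨c, c', ⟨hc0, hc1⟩, ⟨hc'0, hc'1⟩, ε, hε, fun i j y hlt => ?_⟩
  exact (le_max_iff.1 ((hεr (i, j)).trans (hr' (i, j) y))).resolve_left (not_le.2 hlt)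

theorem exists_isDyadicInterval_dist_lt {c : I} (h0 : 0 < c) (h1 : c < 1) {r : ℝ} (hr : 0 < r) :
    ∃ u v, IsDyadicInterval u v ∧ ∀ z ∈ Icc u v, dist z c < r := by
  obtain ⟨a, b, hc, hab⟩ := (mem_nhds_iff_exists_Ioo_subset' ⟨0, h0⟩ ⟨1, h1⟩).1
    (Metric.ball_mem_nhds c hr)
  obtain ⟨u, v, huv, hau, -, -, hvb⟩ := exists_isDyadicInterval hc.1 hc.2
  exact ⟨u, v, huv, fun z hz => hab ⟨hau.trans_le hz.1, hz.2.trans_lt hvb⟩⟩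

/-- Place copies of one nontrivial commutator on dyadic intervals near `c` and `c'`. A point moved
by both `φ f` and `t (φ f') t⁻¹` would be `t y` with `H i (t y)` near `c` and `H j y` near `c'`,
which the choice of `c` and `c'` excludes. -/
theorem exists_commute_conj
    (hsemi : ∀ φ : ThompsonF →* DiffPlusOne, Injective φ →
      IsSemiconjugateTo (DiffPlusOne.subtype.comp φ) ThompsonF.subtype)
    (φ : ThompsonF →* DiffPlusOne) (t : DiffPlusOne) :
    ∃ f f' : ThompsonF, f ≠ 1 ∧ f' ≠ 1 ∧ Commute (φ f) (t * φ f' * t⁻¹) := by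
  obtain ⟨f, g, hf, hg, hne⟩ := ThompsonF.exists_commutator_ne_one
  obtain ⟨ι, _, H, hH, hsupp⟩ := exists_finite_family_semiconj hsemi φ hf hg
  obtain ⟨c, c', ⟨hc0, hc1⟩, ⟨hc'0, hc'1⟩, r, hr, hsep⟩ := exists_separated_fibers hH (t : HomeoPlus)
  obtain ⟨u, v, huv, hd⟩ := exists_isDyadicInterval_dist_lt hc0 hc1 hr
  obtain ⟨u', v', huv', hd'⟩ := exists_isDyadicInterval_dist_lt hc'0 hc'1 hr
  refine ⟨thompsonExtend huv (f * g * f⁻¹ * g⁻¹), thompsonExtend huv' (f * g * f⁻¹ * g⁻¹),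
    ?_, ?_, Subtype.ext (HomeoPlus.commute_of_disjoint fun x => ?_)⟩
  · exact (map_ne_one_iff _ (thompsonExtend_injective huv)).2 hne
  · exact (map_ne_one_iff _ (thompsonExtend_injective huv')).2 hne
  · by_contra! hcon
    obtain ⟨i, hi⟩ := hsupp huv x hcon.1
    obtain ⟨y, rfl⟩ := (t : HomeoPlus).surjective x
    have h2 : (φ (thompsonExtend huv' (f * g * f⁻¹ * g⁻¹)) : HomeoPlus) y ≠ y := by
      intro h
      refine hcon.2 ?_
      change (t : HomeoPlus) ((φ (thompsonExtend huv' (f * g * f⁻¹ * g⁻¹)) : HomeoPlus)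
        ((t : HomeoPlus).symm ((t : HomeoPlus) y))) = _
      rw [OrderIso.symm_apply_apply, h]
    obtain ⟨j, hj⟩ := hsupp huv' y h2
    exact absurd (hd' _ hj) (not_lt.2 (hsep i j y (hd _ hi)))

/-! ### Local indicability of `F`. -/

/-- The image of `χ` is `dℤ` with `d ≠ 0`; divide by `d`. -/
theorem exists_surjective_hom_int {G : Type*} [Group G] (χ : G →* Multiplicative ℤ) {x : G}
    (hx : χ x ≠ 1) : ∃ f : G →* Multiplicative ℤ, Surjective f := by
  obtain ⟨⟨_, x₀, rfl⟩, hgen⟩ := IsCyclic.exists_generator (α := χ.range)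
  set d : ℤ := (χ x₀).toAdd with hd
  have hdvd : ∀ y, d ∣ (χ y).toAdd := by
    intro y
    obtain ⟨k, hk⟩ := hgen ⟨χ y, y, rfl⟩
    refine ⟨k, ?_⟩
    have hk' : χ x₀ ^ k = χ y := congrArg Subtype.val hk
    rw [← hk', hd, toAdd_zpow, smul_eq_mul, mul_comm]
  have hd0 : d ≠ 0 := by
    intro h0
    have := hdvd x
    rw [h0, zero_dvd_iff] at this
    exact hx (Multiplicative.toAdd.injective this)
  refine ⟨⟨⟨fun y => Multiplicative.ofAdd ((χ y).toAdd / d), by simp⟩, fun y z => ?_⟩, fun n => ?_⟩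
  · simp only [map_mul, toAdd_mul]
    rw [Int.add_ediv_of_dvd_left (hdvd y), ofAdd_add]
  · refine ⟨x₀ ^ n.toAdd, ?_⟩
    change Multiplicative.ofAdd ((χ (x₀ ^ n.toAdd)).toAdd / d) = n
    rw [map_zpow, toAdd_zpow, ← hd, smul_eq_mul, Int.mul_ediv_cancel _ hd0]
    rfl

/-- `f` is affine with slope `2 ^ n` to the right of `p`. -/
def HasRightSlope (f : HomeoPlus) (p : I) (n : ℤ) : Prop :=
  ∃ b, p < b ∧ ∀ x ∈ Icc p b, (f x : ℝ) = f p + 2 ^ n * ((x : ℝ) - p)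

theorem IsDyadicPL.exists_hasRightSlope {f : HomeoPlus} (hf : IsDyadicPL f) {p : I} (hp : p < 1) :
    ∃ n, HasRightSlope f p n := by
  classical
  obtain ⟨S, -, hA⟩ := hf
  have hne : (insert 1 (S.filter (p < ·))).Nonempty := Finset.insert_nonempty _ _
  set b := (insert 1 (S.filter (p < ·))).min' hne with hb
  have hpb : p < b := by
    have := Finset.min'_mem _ hne
    rw [← hb, Finset.mem_insert, Finset.mem_filter] at this
    rcases this with h | h
    · rwa [h]
    · exact h.2
  obtain ⟨n, hn⟩ := hA p b hpb.le (by
    rw [Set.disjoint_left]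
    intro y hy hyS
    exact absurd (Finset.min'_le _ y (Finset.mem_insert_of_mem (Finset.mem_filter.2 ⟨hyS, hy.1⟩)))
      (not_le.2 hy.2))
  exact ⟨n, b, hpb, hn⟩

theorem HasRightSlope.unique {f : HomeoPlus} {p : I} {m n : ℤ} (hm : HasRightSlope f p m)
    (hn : HasRightSlope f p n) : m = n := by
  obtain ⟨b, hb, hm⟩ := hm
  obtain ⟨c, hc, hn⟩ := hn
  have hp : p < min b c := lt_min hb hc
  have h1 := hm _ ⟨hp.le, min_le_left b c⟩
  have h2 := hn _ ⟨hp.le, min_le_right b c⟩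
  have h3 : ((min b c : I) : ℝ) - p ≠ 0 := (coe_sub_pos hp).ne'
  refine zpow_right_injective₀ (a := (2 : ℝ)) (by norm_num) (by norm_num) ?_
  exact mul_right_cancel₀ h3 (by linarith)

theorem HasRightSlope.mul {f g : HomeoPlus} {p : I} {m n : ℤ} (hf : HasRightSlope f p m)
    (hg : HasRightSlope g p n) (hp : g p = p) : HasRightSlope (f * g) p (m + n) := by
  obtain ⟨b, hb, hf⟩ := hf
  obtain ⟨c, hc, hg⟩ := hg
  refine ⟨min c (g.symm b), lt_min hc ?_, fun x hx => ?_⟩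
  · rwa [OrderIso.lt_symm_apply, hp]
  · have h1 := hf (g x) ⟨hp.symm.le.trans (g.monotone hx.1),
      g.le_symm_apply.1 (hx.2.trans (min_le_right _ _))⟩
    have h2 := hg x ⟨hx.1, hx.2.trans (min_le_left _ _)⟩
    rw [RelIso.mul_apply, RelIso.mul_apply, h1, h2, hp, zpow_add₀ two_ne_zero]
    ring

/-- Let `p` be the infimum of the points moved by `H`. Then `H` fixes `p`, and the exponent of the
right slope at `p` is a homomorphism to `ℤ`. If it vanished, the finitely many generators would all
be the identity on a common interval to the right of `p`, and so would `H`, contradicting the choice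
of `p`. -/
theorem ThompsonF.isLocallyIndicable : IsLocallyIndicable ThompsonF := by
  intro H ⟨S, hS⟩ hH
  obtain ⟨h₀, hh₀, hh₀1⟩ := H.bot_or_exists_ne_one.resolve_left hH
  obtain ⟨y₀, hy₀⟩ := ThompsonF.exists_apply_ne hh₀1
  set M : Set I := {y | ∃ h ∈ H, (h : HomeoPlus) y ≠ y} with hM
  set p := sInf M with hpdef
  have hlow : ∀ y < p, ∀ h ∈ H, (h : HomeoPlus) y = y := by
    intro y hy h hh
    by_contra hne
    exact absurd (sInf_le (show y ∈ M from ⟨h, hh, hne⟩)) (not_le.2 hy)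
  have hle : ∀ h ∈ H, p ≤ (h : HomeoPlus) p := by
    intro h hh
    by_contra! hlt
    exact hlt.ne ((h : HomeoPlus).injective (hlow _ hlt h hh))
  have hfix : ∀ h ∈ H, (h : HomeoPlus) p = p := by
    intro h hh
    refine le_antisymm ?_ (hle h hh)
    exact (h : HomeoPlus).le_symm_apply.1 (hle h⁻¹ (H.inv_mem hh))
  have hp1 : p < 1 := by
    refine lt_of_le_of_lt (sInf_le (show y₀ ∈ M from ⟨h₀, hh₀, hy₀⟩)) (lt_top_iff_ne_top.2 ?_)
    intro h
    rw [show y₀ = 1 from h, HomeoPlus.map_one] at hy₀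
    exact hy₀ rfl
  choose n hn using fun f : ThompsonF => IsDyadicPL.exists_hasRightSlope f.2 hp1
  let χ : H →* Multiplicative ℤ := MonoidHom.mk' (fun h => Multiplicative.ofAdd (n h))
    fun f g => congrArg Multiplicative.ofAdd
      ((hn (f * g : H)).unique ((hn f).mul (hn g) (hfix g g.2)))
  by_cases hχ : ∃ h, χ h ≠ 1
  · obtain ⟨h, hh⟩ := hχ
    exact exists_surjective_hom_int χ hh
  · exfalso
    push Not at hχ
    have hzero : ∀ h ∈ H, n h = 0 := fun h hh => Multiplicative.ofAdd.injective (hχ ⟨h, hh⟩)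
    choose b hb hb' using fun f : ThompsonF => hn f
    obtain ⟨c, hpc, hc⟩ : ∃ c, p < c ∧ ∀ s ∈ S, c ≤ b s := by
      rcases S.eq_empty_or_nonempty with rfl | hSn
      · exact ⟨1, hp1, by simp⟩
      · exact ⟨S.inf' hSn b, (Finset.lt_inf'_iff hSn).2 fun s _ => hb s,
          fun s hs => Finset.inf'_le b hs⟩
    have hSH : ∀ s ∈ S, s ∈ H := fun s hs => hS ▸ Subgroup.subset_closure hs
    have hgen : ∀ s ∈ S, ∀ y ≤ c, (s : HomeoPlus) y = y := by
      intro s hs y hy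
      rcases lt_or_ge y p with hyp | hyp
      · exact hlow y hyp s (hSH s hs)
      · refine Subtype.ext ?_
        rw [hb' s y ⟨hyp, hy.trans (hc s hs)⟩, hzero s (hSH s hs), hfix s (hSH s hs)]
        simp
    have hall : ∀ h ∈ H, ∀ y ≤ c, (h : HomeoPlus) y = y := by
      intro h hh
      rw [← hS] at hh
      induction hh using Subgroup.closure_induction with
      | mem s hs => exact hgen s hs
      | one => exact fun y _ => rfl
      | mul f g _ _ hf hg =>
        intro y hy
        change (f : HomeoPlus) ((g : HomeoPlus) y) = y
        rw [hg y hy, hf y hy]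
      | inv f _ hf =>
        exact fun y hy => (OrderIso.symm_apply_eq (f : HomeoPlus)).2 (hf y hy).symm
    refine absurd (le_sInf fun y hy => ?_ : c ≤ p) (not_le.2 hpc)
    obtain ⟨h, hh, hne⟩ := hy
    exact (not_le.1 fun hyc => hne (hall h hh y hyc)).le

/-! ### The free product with `ℤ` inside a semidirect product. -/

section

open SemidirectProduct

variable {A : Type*} [Group A]

/-- The action of `A` on the free group on `A` by translation of the generators. -/
def freeGroupTranslation (A : Type*) [Group A] : A →* MulAut (FreeGroup A) where
  toFun a := FreeGroup.freeGroupCongr (Equiv.mulLeft a)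
  map_one' := MulEquiv.toMonoidHom_injective (FreeGroup.ext_hom _ _ fun x => by simp)
  map_mul' a b := MulEquiv.toMonoidHom_injective (FreeGroup.ext_hom _ _ fun x => by simp [mul_assoc])

theorem freeGroupTranslation_of (a b : A) :
    freeGroupTranslation A a (FreeGroup.of b) = FreeGroup.of (a * b) := by
  simp [freeGroupTranslation]

/-- The map from `A * ℤ` to `FreeGroup A ⋊ A` that sends the generator of `ℤ` to the generator of
the free group with index `1`. -/
def coprodIntToSemidirect (A : Type*) [Group A] :
    Monoid.Coprod A (Multiplicative ℤ) →* FreeGroup A ⋊[freeGroupTranslation A] A :=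
  Monoid.Coprod.lift inr (zpowersHom _ (inl (FreeGroup.of 1)))

theorem coprodIntToSemidirect_inl (a : A) :
    coprodIntToSemidirect A (Monoid.Coprod.inl a) = inr a := by
  simp [coprodIntToSemidirect]

theorem coprodIntToSemidirect_inr :
    coprodIntToSemidirect A (Monoid.Coprod.inr (Multiplicative.ofAdd 1)) =
      inl (FreeGroup.of 1) := by
  simp [coprodIntToSemidirect]

/-- A left inverse sends the free generator with index `a` to the conjugate `a t a⁻¹`, where `t`
generates `ℤ`. -/
theorem coprodIntToSemidirect_injective : Injective (coprodIntToSemidirect A) := by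
  let t : Monoid.Coprod A (Multiplicative ℤ) := Monoid.Coprod.inr (Multiplicative.ofAdd 1)
  let k : FreeGroup A ⋊[freeGroupTranslation A] A →* Monoid.Coprod A (Multiplicative ℤ) :=
    SemidirectProduct.lift
      (FreeGroup.lift fun a => Monoid.Coprod.inl a * t * (Monoid.Coprod.inl a)⁻¹)
      Monoid.Coprod.inl fun a => FreeGroup.ext_hom _ _ fun b => by
        simp [freeGroupTranslation_of, mul_assoc]
  have hk : k.comp (coprodIntToSemidirect A) = MonoidHom.id _ := by
    refine Monoid.Coprod.hom_ext (MonoidHom.ext fun a => ?_) (MonoidHom.ext_mint ?_)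
    · simp [k, coprodIntToSemidirect_inl]
    · simp [k, coprodIntToSemidirect_inr, t]
  exact Function.LeftInverse.injective (g := k) (DFunLike.congr_fun hk)

theorem not_commute_inl_conj_inl {a b : A} (ha : a ≠ 1) (hb : b ≠ 1) :
    ¬ Commute (Monoid.Coprod.inl a : Monoid.Coprod A (Multiplicative ℤ))
      (Monoid.Coprod.inr (Multiplicative.ofAdd 1) * Monoid.Coprod.inl b *
        (Monoid.Coprod.inr (Multiplicative.ofAdd 1))⁻¹) := by
  classical
  intro h
  have h1 := congrArg (fun x => (coprodIntToSemidirect A x).left) h.eq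
  simp only [map_mul, map_inv, coprodIntToSemidirect_inl, coprodIntToSemidirect_inr, mul_left,
    mul_right, left_inl, left_inr, right_inl, right_inr, inv_left, inv_right,
    freeGroupTranslation_of, _root_.map_one, one_mul, mul_one, inv_one, MulAut.one_apply] at h1
  -- With `x_c` the free generator of index `c`, the free parts of the two products are `x_a
  -- x_{ab}⁻¹` and `x_1 x_b⁻¹`. The exponent sum of `x_1` is `0` or `-1` in the first and `1` in the
  -- second.
  have h2 := congrArg (FreeGroup.lift fun x : A => Multiplicative.ofAdd (if x = 1 then (1 : ℤ) else 0)) h1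
  have h3 := congrArg Multiplicative.toAdd h2
  simp [ha, hb] at h3
  split_ifs at h3; omega

theorem exists_surjective_hom_int_of_isFreeGroup {G : Type*} [Group G] [IsFreeGroup G]
    [Nontrivial G] : ∃ f : G →* Multiplicative ℤ, Surjective f := by
  have hne : Nonempty (IsFreeGroup.Generators G) := by
    by_contra hemp
    rw [not_nonempty_iff] at hemp
    exact not_subsingleton G (IsFreeGroup.toFreeGroup G).toEquiv.subsingleton
  obtain ⟨i⟩ := hne
  refine exists_surjective_hom_int
    (IsFreeGroup.lift fun _ : IsFreeGroup.Generators G => Multiplicative.ofAdd (1 : ℤ))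
    (x := IsFreeGroup.of i) ?_
  rw [IsFreeGroup.lift_of]
  exact fun h => one_ne_zero (Multiplicative.ofAdd.injective h)

/-- If the projection of `H` to `A` is nontrivial, compose it with a map from its image onto `ℤ`.
Otherwise `H` embeds in `FreeGroup A`, so it is free by the Nielsen–Schreier theorem. -/
theorem IsLocallyIndicable.coprod_int (hA : IsLocallyIndicable A) :
    IsLocallyIndicable (Monoid.Coprod A (Multiplicative ℤ)) := by
  intro H hfg hH
  set π : Monoid.Coprod A (Multiplicative ℤ) →* A := rightHom.comp (coprodIntToSemidirect A) with hπ
  by_cases hbot : H.map π = ⊥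
  · have hr : ∀ x : H, (coprodIntToSemidirect A x).right = 1 := fun x =>
      (Subgroup.eq_bot_iff_forall _).1 hbot _ ⟨x, x.2, rfl⟩
    let j : H →* FreeGroup A :=
      { toFun := fun x => (coprodIntToSemidirect A x).left
        map_one' := by simp
        map_mul' := fun x y => by simp [hr] }
    have hj : Injective j := fun x y hxy => Subtype.ext
      (coprodIntToSemidirect_injective (SemidirectProduct.ext hxy ((hr x).trans (hr y).symm)))
    have : IsFreeGroup H := IsFreeGroup.ofMulEquiv (MonoidHom.ofInjective hj).symm
    have : Nontrivial H := (Subgroup.nontrivial_iff_ne_bot H).2 hH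
    exact exists_surjective_hom_int_of_isFreeGroup
  · have hfg' : (H.map π).FG := by
      have := (Group.fg_iff_subgroup_fg H).2 hfg
      exact (Group.fg_iff_subgroup_fg _).1 (Group.fg_of_surjective (π.subgroupMap_surjective H))
    obtain ⟨f, hf⟩ := hA _ hfg' hbot
    exact ⟨f.comp (π.subgroupMap H), hf.comp (π.subgroupMap_surjective H)⟩

end

theorem mainTheorem8
    (hsemi : ∀ φ : ThompsonF →* DiffPlusOne, Injective φ →
      IsSemiconjugateTo (DiffPlusOne.subtype.comp φ) ThompsonF.subtype) :
    IsLocallyIndicable (Monoid.Coprod ThompsonF (Multiplicative ℤ)) ∧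
      ¬ ∃ ψ : Monoid.Coprod ThompsonF (Multiplicative ℤ) →* DiffPlusOne, Injective ψ := by
  refine ⟨ThompsonF.isLocallyIndicable.coprod_int, fun ⟨ψ, hψ⟩ => ?_⟩
  obtain ⟨f, f', hf, hf', hcomm⟩ := exists_commute_conj hsemi (ψ.comp Monoid.Coprod.inl)
    (ψ (Monoid.Coprod.inr (Multiplicative.ofAdd 1)))
  refine not_commute_inl_conj_inl hf hf' (hψ ?_)
  simpa using hcomm.eq
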